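/- Let $\mathfrak g$ be a finite-dimensional reductive complex Lie algebra of ADE type, that is, a direct sum of an abelian ideal and finitely many simple ideals of Dynkin types $A_n$, $D_n$, $E_6$, $E_7$, $E_8$. Let $\mathfrak t\subset\mathfrak g$ be a Cartan subalgebra and $R\subset\mathfrak t^*\setminus\{0\}$ the set of roots, and for $\alpha\in R$ let the coroot $h_\alpha$ be the unique element of $[\mathfrak g,\mathfrak g]\cap\mathfrak t$ with $\alpha=2K(-,h_\alpha)/K(h_\alpha,h_\alpha)$ on $\mathfrak t$, where $K$ is the Killing form of $\mathfrak g$. Let $\mathfrak g^\vee$ be a Langlands dual of $\mathfrak g$: a finite-dimensional reductive complex Lie algebra with a Cartan subalgebra $\mathfrak t^\vee$ and a linear identification $\mathfrak t^\vee=\mathfrak t^*$ (hence $(\mathfrak t^\vee)^*=\mathfrak t$) under which the set of roots of $(\mathfrak g^\vee,\mathfrak t^\vee)$ is the set $\{h_\alpha:\alpha\in R\}\subset\mathfrak t$ and, for every $\alpha\in R$, the coroot belonging to the root $\alpha^\vee:=h_\alpha$ of $\mathfrak g^\vee$ is $\alpha\in\mathfrak t^*$. (For example, $\mathfrak g$ and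 $\mathfrak g^\vee$ are the Lie algebras of a complex reductive group $G$ and of its Langlands dual group $G^\vee$, whose root datum is the dual of that of $G$.) Write $h_\alpha^\vee\in\mathfrak t^*=\mathfrak t^\vee$ for the coroot of the root $\alpha^\vee$ of $\mathfrak g^\vee$. Then $\alpha(h_\beta)=\beta(h_\alpha)$ for all $\alpha,\beta\in R$, and there is an isomorphism of Lie algebras $\phi:\mathfrak g\to\mathfrak g^\vee$ with $\phi(h_\alpha)=h_\alpha^\vee$ for every $\alpha\in R$. -/

import Mathlib

open Module

noncomputable section

namespace ReductiveLie

/-- A Lie algebra is reductive if every ideal has a complementary ideal. -/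
def IsReductive (𝔤 : Type*) [LieRing 𝔤] [LieAlgebra ℂ 𝔤] : Prop :=
  ∀ 𝔞 : LieIdeal ℂ 𝔤, ∃ 𝔟 : LieIdeal ℂ 𝔤, IsCompl 𝔞 𝔟

/-- The Cartan matrices of Dynkin types `Aₙ` (`n ≥ 1`), `Dₙ` (`n ≥ 4`), `E₆`, `E₇`, `E₈`,
up to the labelling of the nodes. -/
def IsADECartanMatrix {ι : Type*} (M : Matrix ι ι ℤ) : Prop :=
  (∃ n : ℕ, 1 ≤ n ∧ ∃ f : ι ≃ Fin n, M.reindex f f = CartanMatrix.A n) ∨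
  (∃ n : ℕ, 4 ≤ n ∧ ∃ f : ι ≃ Fin n, M.reindex f f = CartanMatrix.D n) ∨
  (∃ f : ι ≃ Fin 6, M.reindex f f = CartanMatrix.E₆) ∨
  (∃ f : ι ≃ Fin 7, M.reindex f f = CartanMatrix.E₇) ∨
  (∃ f : ι ≃ Fin 8, M.reindex f f = CartanMatrix.E₈)

/-- A simple complex Lie algebra whose Dynkin type is A, D or E. -/
def IsSimpleOfTypeADE (𝔰 : Type*) [LieRing 𝔰] [LieAlgebra ℂ 𝔰] [FiniteDimensional ℂ 𝔰] : Prop :=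
  ∃ (_ : LieAlgebra.IsSimple ℂ 𝔰) (𝔥 : LieSubalgebra ℂ 𝔰) (_ : 𝔥.IsCartanSubalgebra)
    (b : (LieAlgebra.IsKilling.rootSystem 𝔥).Base), IsADECartanMatrix b.cartanMatrix

/-- A Lie algebra is of ADE type if it is the direct sum of an abelian ideal and finitely many
simple ideals of types A, D or E. -/
def IsADEType (𝔤 : Type*) [LieRing 𝔤] [LieAlgebra ℂ 𝔤] [FiniteDimensional ℂ 𝔤] : Prop :=
  ∃ (n : ℕ) (𝔞 : LieIdeal ℂ 𝔤) (𝔰 : Fin n → LieIdeal ℂ 𝔤),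
    IsLieAbelian 𝔞 ∧ (∀ i, IsSimpleOfTypeADE (𝔰 i)) ∧
    iSupIndep (fun o : Option (Fin n) ↦ o.elim 𝔞 𝔰) ∧
    (⨆ o : Option (Fin n), o.elim 𝔞 𝔰) = ⊤

section Roots

variable {𝔤 : Type*} [LieRing 𝔤] [LieAlgebra ℂ 𝔤]

/-- The roots of `𝔤` with respect to `𝔱`: the nonzero linear forms on `𝔱` which occur as
simultaneous eigenvalues of `ad 𝔱` on `𝔤`. -/
def roots (𝔱 : LieSubalgebra ℂ 𝔤) : Set (Dual ℂ 𝔱) :=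
  {α | α ≠ 0 ∧ ∃ X : 𝔤, X ≠ 0 ∧ ∀ h : 𝔱, ⁅(h : 𝔤), X⁆ = α h • X}

/-- `h` is a coroot of `α`: it lies in `[𝔤, 𝔤] ∩ 𝔱` and `α = 2 K(-, h) / K(h, h)` on `𝔱`,
where `K` is the Killing form of `𝔤`. -/
def IsCorootOf (𝔱 : LieSubalgebra ℂ 𝔤) (α : Dual ℂ 𝔱) (h : 𝔱) : Prop :=
  (h : 𝔤) ∈ ⁅(⊤ : LieIdeal ℂ 𝔤), (⊤ : LieIdeal ℂ 𝔤)⁆ ∧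
    ∀ x : 𝔱, α x = 2 * (killingForm ℂ 𝔤 x h / killingForm ℂ 𝔤 h h)

open Classical in
/-- The coroot `h_α` of a root `α`: the element of `[𝔤, 𝔤] ∩ 𝔱` satisfying
`α = 2 K(-, h_α) / K(h_α, h_α)`. If `𝔤` is reductive and `𝔱` is a Cartan subalgebra, there is
exactly one such element for every root `α`. (The value is `0` if there is no such element.) -/
def coroot (𝔱 : LieSubalgebra ℂ 𝔤) (α : Dual ℂ 𝔱) : 𝔱 :=
  if H : ∃ h : 𝔱, IsCorootOf 𝔱 α h then H.choose else 0

end Roots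

section Duality

variable {𝔤 𝔤' : Type*} [LieRing 𝔤] [LieAlgebra ℂ 𝔤] [LieRing 𝔤'] [LieAlgebra ℂ 𝔤']

/-- An identification `e : 𝔱* ≃ 𝔱'` turns an element `h` of `𝔱` into a linear form on `𝔱'`,
namely evaluation at `h`. -/
def asForm {𝔱 : LieSubalgebra ℂ 𝔤} {𝔱' : LieSubalgebra ℂ 𝔤'} (e : Dual ℂ 𝔱 ≃ₗ[ℂ] 𝔱') (h : 𝔱) :
    Dual ℂ 𝔱' :=
  Dual.eval ℂ 𝔱 h ∘ₗ e.symm.toLinearMap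

/-- A Langlands duality between `(𝔤, 𝔱)` and `(𝔤', 𝔱')`: an identification `𝔱' = 𝔱*` under which
the root datum of `(𝔤', 𝔱')` becomes the dual of the root datum of `(𝔤, 𝔱)`. That is, the roots of
`𝔤'` are the coroots `h_α ∈ 𝔱 = (𝔱*)*` of `𝔤`, and the coroot of `𝔤'` which belongs to the root
`h_α` is `α ∈ 𝔱*`. -/
structure LanglandsDuality (𝔱 : LieSubalgebra ℂ 𝔤) (𝔱' : LieSubalgebra ℂ 𝔤') where
  /-- the identification `𝔱* = 𝔱'` -/
  toEquiv : Dual ℂ 𝔱 ≃ₗ[ℂ] 𝔱'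
  roots_eq : roots 𝔱' = (fun α ↦ asForm toEquiv (coroot 𝔱 α)) '' roots 𝔱
  coroot_eq : ∀ α ∈ roots 𝔱, coroot 𝔱' (asForm toEquiv (coroot 𝔱 α)) = toEquiv α

variable {𝔱 : LieSubalgebra ℂ 𝔤} {𝔱' : LieSubalgebra ℂ 𝔤'}

/-- The root `α^∨` of `𝔤'` which corresponds to the root `α` of `𝔤`: the coroot `h_α`,
viewed as a root of `𝔤'`. -/
def LanglandsDuality.dualRoot (D : LanglandsDuality 𝔱 𝔱') (α : Dual ℂ 𝔱) : Dual ℂ 𝔱' :=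
  asForm D.toEquiv (coroot 𝔱 α)

/-- The dual coroot `h_α^∨ ∈ 𝔱' = 𝔱*`: the coroot of the root `α^∨` of `𝔤'`. For a root `α`
it is equal to `α ∈ 𝔱* = 𝔱'`. -/
def LanglandsDuality.dualCoroot (D : LanglandsDuality 𝔱 𝔱') (α : Dual ℂ 𝔱) : 𝔱' :=
  coroot 𝔱' (D.dualRoot α)

end Duality

end ReductiveLie

end

/-! Reductivity splits `𝔤 = S ⊕ Z` with `S` semisimple and `Z` central
(`IsReductive.exists_isCompl`). Root vectors and coroots are seen on `S`, and `𝔱 = (𝔱 ∩ S) ⊕ Z`.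

Symmetry (`IsADEType.apply_coroot_comm`). Every root comes from one of the simple ideals, and roots
of different ideals pair to zero. Within a simple ideal, a symmetric Cartan matrix forces a
symmetric pairing of all roots (`Base.pairing_comm_of_isSymm`). The ADE hypothesis concerns some
Cartan subalgebra of the ideal, perhaps not the one cut out by `𝔱`, so conjugacy of Cartan
subalgebras is needed (`exists_equiv_forall_mem_iff`). It is proved analytically: the conjugates of
those elements of `H` on which no root vanishes form an open set, two such sets are equal or
disjoint, and a complex line minus its finitely many non-regular points is connected.

Isomorphism (`LanglandsDuality.exists_equiv`). By duality `α^∨(h_β^∨) = β(h_α)`, which is `α(h_β)`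
by symmetry. So `α ↦ α^∨` is a bijection of root systems preserving the pairing, and the isomorphism
theorem (`exists_equiv_of_pairing_eq`) yields `S ≃ S'` matching coroots. The centres have equal
dimension because the Cartan subalgebras and the ranks agree; any linear isomorphism between them
completes the map.

The isomorphism theorem rests on Chevalley generators (`exists_basis`): the subalgebra of `L₁ × L₂`
generated by pairs of matching generators is the graph of an isomorphism
(`LieAlgebra.Basis.exists_equiv`). -/

noncomputable section

/-! ### Root vectors and Chevalley generators. -/

namespace LieAlgebra.IsKilling

open LieModule Set Function

section RootSpaces

variable {K L : Type*} [Field K] [CharZero K] [LieRing L] [LieAlgebra K L]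
  [IsKilling K L] [FiniteDimensional K L]
  {H : LieSubalgebra K L} [H.IsCartanSubalgebra] [IsTriangularizable K H L]

lemma exists_smul_eq_of_mem_rootSpace {α : Weight K H L} (hα : α.IsNonZero) {x y : L}
    (hx : x ∈ rootSpace H α) (hx₀ : x ≠ 0) (hy : y ∈ rootSpace H α) : ∃ c : K, c • x = y := by
  obtain ⟨c, hc⟩ := (finrank_eq_one_iff_of_nonzero' ⟨x, hx⟩ (by simpa using hx₀)).mp
    (finrank_rootSpace_eq_one α hα) ⟨y, hy⟩
  exact ⟨c, congr_arg Subtype.val hc⟩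

/-- The bracket of root vectors for `α` and `β` does not vanish if `α + β` is a weight. -/
lemma lie_ne_zero_of_mem_rootSpace {α β : Weight K H L} (hα : α.IsNonZero) (hβ : β.IsNonZero)
    (hαβ : rootSpace H (α + β : H → K) ≠ ⊥) {x y : L} (hx : x ∈ rootSpace H α) (hx₀ : x ≠ 0)
    (hy : y ∈ rootSpace H β) (hy₀ : y ≠ 0) : ⁅x, y⁆ ≠ 0 := by
  obtain ⟨h, e, f, isSl2, he, hf⟩ := exists_isSl2Triple_of_weight_isNonZero hα
  obtain rfl := isSl2.h_eq_coroot hα he hf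
  obtain ⟨z, hz, hz₀⟩ := (chainTop α β).exists_ne_zero
  have prim : isSl2.HasPrimitiveVectorWith z (chainLength α β : K) :=
    have := lie_mem_genWeightSpace_of_mem_genWeightSpace he hz
    ⟨hz₀, (chainLength_smul _ _ hz).symm, by rwa [genWeightSpace_add_chainTop _ _ hα] at this⟩
  -- Since `α + β` is a weight, `β` lies `p + 1 ≥ 1` steps below the top of its `α`-chain. So `y` is
  -- a multiple of `f ^ (p + 1) z`, and `e` maps this to `(p + 1) (chainLength - p)` times `f ^ p
  -- z`.
  obtain ⟨p, hp⟩ : ∃ p, chainTopCoeff α β = p + 1 := by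
    refine Nat.exists_eq_succ_of_ne_zero fun h₀ ↦ hαβ ?_
    have := genWeightSpace_chainTopCoeff_add_one_nsmul_add (M := L) (α : H → K) β hα
    simpa [h₀] using this
  have hle : p + 1 ≤ chainLength α β := hp ▸ chainTopCoeff_le_chainLength α β
  have hmem : (toEnd K L L f ^ (p + 1)) z ∈ rootSpace H β := by
    have := toEnd_pow_apply_mem hf hz (p + 1)
    rwa [coe_chainTop', hp, smul_neg, neg_add_cancel_left] at this
  have hne := prim.pow_toEnd_f_ne_zero_of_eq_nat rfl hle
  obtain ⟨c, rfl⟩ := exists_smul_eq_of_mem_rootSpace hβ hmem hne hy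
  obtain ⟨d, rfl⟩ := exists_smul_eq_of_mem_rootSpace hα he isSl2.e_ne_zero hx
  rw [smul_lie, lie_smul, prim.lie_e_pow_succ_toEnd_f]
  have h₁ : ((p : K) + 1) ≠ 0 := by exact_mod_cast p.succ_ne_zero
  have h₂ : ((chainLength α β : K) - p) ≠ 0 := by
    rw [sub_ne_zero]; exact_mod_cast (by omega : chainLength α β ≠ p)
  have h₃ := prim.pow_toEnd_f_ne_zero_of_eq_nat rfl (i := p) (by omega)
  simp only [ne_eq, smul_eq_zero, mul_eq_zero, not_or] at *
  tauto

omit [CharZero K] [IsKilling K L] [FiniteDimensional K L] [IsTriangularizable K H L] in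
lemma mem_rootSpace_of_forall_lie_eq {α : H → K} {x : L} (h : ∀ t : H, ⁅(t : L), x⁆ = α t • x) :
    x ∈ rootSpace H α :=
  weightSpace_le_genWeightSpace L α ((mem_weightSpace α x).mpr h)

end RootSpaces

section Basis

variable {K L : Type*} [Field K] [CharZero K] [LieRing L] [LieAlgebra K L]
  [IsKilling K L] [FiniteDimensional K L]
  {H : LieSubalgebra K L} [H.IsCartanSubalgebra] [IsTriangularizable K H L]

/-- A subalgebra containing `H` and root vectors for all simple roots and their negatives
is everything. -/
lemma eq_top_of_forall_mem_support (b : (rootSystem H).Base) (D : LieSubalgebra K L) (hH : H ≤ D)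
    (hD : ∀ i ∈ b.support, (rootSpace H i.1 : Set L) ⊆ D)
    (hD' : ∀ i ∈ b.support, (rootSpace H (-i.1) : Set L) ⊆ D) : D = ⊤ := by
  have step (i j k : H.root) (hk : (k.1 : H → K) = j.1 + i.1)
      (hi : (rootSpace H i.1 : Set L) ⊆ D) (hj : (rootSpace H j.1 : Set L) ⊆ D) :
      (rootSpace H k.1 : Set L) ⊆ D := by
    intro z hz
    obtain ⟨x, hx, hx₀⟩ := i.1.exists_ne_zero
    obtain ⟨y, hy, hy₀⟩ := j.1.exists_ne_zero
    have h₁ := lie_ne_zero_of_mem_rootSpace (H.isNonZero_coe_root j) (H.isNonZero_coe_root i)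
      (hk ▸ k.1.genWeightSpace_ne_bot) hy hy₀ hx hx₀
    have h₂ := lie_mem_genWeightSpace_of_mem_genWeightSpace hy hx
    rw [← hk] at h₂
    obtain ⟨c, rfl⟩ := exists_smul_eq_of_mem_rootSpace (H.isNonZero_coe_root k) h₂ h₁ hz
    exact D.smul_mem c (D.lie_mem (hj hy) (hi hx))
  let := (rootSystem H).indexNeg
  have neg (i : H.root) : ((-i).1 : H → K) = -i.1 := by
    ext t
    have := ((rootSystem H).root_reflectionPerm i i).trans ((rootSystem H).reflection_apply_self i)
    exact LinearMap.congr_fun this t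
  -- A positive root is reached from a simple one by adding simple roots, all partial sums being
  -- roots; negatives are carried along.
  have key (i : H.root) (hi : b.IsPos i) : (rootSpace H i.1 : Set L) ⊆ D ∧
      (rootSpace H (-i.1) : Set L) ⊆ D := by
    refine hi.induction_on_add
      (p := fun i ↦ (rootSpace H i.1 : Set L) ⊆ D ∧ (rootSpace H (-i.1) : Set L) ⊆ D)
      (fun i hi ↦ ⟨hD i hi, hD' i hi⟩) fun i j k hk ⟨h₁, h₂⟩ hj ↦ ?_
    have hk' : (k.1 : H → K) = j.1 + i.1 := by
      ext t; simpa [add_comm] using LinearMap.congr_fun hk t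
    refine ⟨step i j k hk' h₁ (hD j hj), ?_⟩
    have := step (-i) (-j) (-k) (by rw [neg, neg, neg, hk', neg_add]) (by rwa [neg])
      (by rw [neg]; exact hD' j hj)
    rwa [neg] at this
  suffices (⊤ : Submodule K L) ≤ D.toSubmodule from
    (eq_top_iff.mpr fun x _ ↦ this Submodule.mem_top)
  rw [← LieSubmodule.top_toSubmodule (R := K) (L := H), ← cartan_sup_iSup_rootSpace_eq_top H]
  simp only [LieSubmodule.sup_toSubmodule, LieSubmodule.iSup_toSubmodule, sup_le_iff, iSup_le_iff]
  refine ⟨hH, fun α hα ↦ ?_⟩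
  let i : H.root := ⟨α, by simpa using hα⟩
  rcases RootPairing.Base.IsPos.or_neg b i with hi | hi
  · exact (key i hi).1
  · have := (key _ hi).2
    rwa [neg, neg_neg] at this

/-- A base of the root system of a Lie algebra with non-degenerate Killing form yields Chevalley
generators. -/
theorem exists_basis (b : (rootSystem H).Base) :
    ∃ c : LieAlgebra.Basis b.support H, c.A = b.cartanMatrix ∧
      ∀ i, c.h i = coroot (i : H.root).1 := by
  have ex (i : b.support) := exists_isSl2Triple_of_weight_isNonZero (H.isNonZero_coe_root i.1)
  choose h e f sl2 he hf using ex
  have hh (i) : h i = coroot (i : H.root).1 := (sl2 i).h_eq_coroot (H.isNonZero_coe_root i.1) (he i) (hf i)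
  have hmem (i) : h i ∈ H := hh i ▸ (coroot (i : H.root).1).2
  have hA (i j : b.support) : (i : H.root).1 ⟨h j, hmem j⟩ = (b.cartanMatrix i j : K) := by
    have := b.algebraMap_cartanMatrixIn_apply ℤ i j
    have h' : (⟨h j, hmem j⟩ : H) = coroot (j : H.root).1 := Subtype.ext (hh j)
    rw [h']
    exact this.symm
  have hspan : Submodule.span K (range h) = H.toSubmodule := by
    have := b.span_coroot_support
    have := congr_arg (Submodule.map H.toSubmodule.subtype)
      (this.trans (RootPairing.IsRootSystem.span_coroot_eq_top (P := rootSystem H)))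
    rw [Submodule.map_span, Submodule.map_top, Submodule.range_subtype] at this
    rw [← this]
    congr 1
    ext x
    simp [hh]
  have hlie (x y : L) (hx : x ∈ H) (hy : y ∈ H) : ⁅x, y⁆ = 0 :=
    congr_arg Subtype.val (trivial_lie_zero H H ⟨x, hx⟩ ⟨y, hy⟩)
  have hH : H = LieSubalgebra.lieSpan K L (range h) := by
    rw [← LieSubalgebra.toSubmodule_inj, LieSubalgebra.coe_lieSpan_eq_span_of_forall_lie_eq_zero,
      hspan]
    rintro - ⟨i, rfl⟩ - ⟨j, rfl⟩
    exact hlie _ _ (hmem i) (hmem j)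
  refine ⟨
    { A := b.cartanMatrix
      h := h
      e := e
      f := f
      cartan_eq_lieSpan := hH
      span_ef := ?_
      linInd := ?_
      nondegen := b.cartanMatrix_nondegenerate
      sl2 := sl2
      lie_h_h i j := hlie _ _ (hmem i) (hmem j)
      lie_h_e i j := ?_
      lie_h_f i j := ?_
      lie_e_f_ne i j hij := ?_ }, rfl, hh⟩
  · apply eq_top_of_forall_mem_support b
    · refine hH.le.trans (LieSubalgebra.lieSpan_le.mpr ?_)
      rintro - ⟨i, rfl⟩
      rw [← (sl2 i).lie_e_f]
      exact LieSubalgebra.lie_mem _ (LieSubalgebra.subset_lieSpan (.inl ⟨i, rfl⟩))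
        (LieSubalgebra.subset_lieSpan (.inr ⟨i, rfl⟩))
    · intro i hi x hx
      obtain ⟨c, rfl⟩ := exists_smul_eq_of_mem_rootSpace (H.isNonZero_coe_root i) (he ⟨i, hi⟩)
        (sl2 ⟨i, hi⟩).e_ne_zero hx
      exact LieSubalgebra.smul_mem _ _ (LieSubalgebra.subset_lieSpan (.inl ⟨_, rfl⟩))
    · intro i hi x hx
      obtain ⟨c, rfl⟩ := exists_smul_eq_of_mem_rootSpace (α := -i.1)
        (H.isNonZero_coe_root i).neg (hf ⟨i, hi⟩)
        (sl2 ⟨i, hi⟩).f_ne_zero hx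
      exact LieSubalgebra.smul_mem _ _ (LieSubalgebra.subset_lieSpan (.inr ⟨_, rfl⟩))
  · have := LinearIndependent.map' b.linearIndepOn_coroot H.toSubmodule.subtype
      (Submodule.ker_subtype _)
    exact (funext hh : h = _) ▸ this
  · have := lie_eq_smul_of_mem_rootSpace (he i) ⟨h j, hmem j⟩
    rw [hA, Int.cast_smul_eq_zsmul] at this
    exact this
  · have := lie_eq_smul_of_mem_rootSpace (hf i) ⟨h j, hmem j⟩
    rw [Pi.neg_apply, hA, ← Int.cast_neg, Int.cast_smul_eq_zsmul] at this
    exact this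
  -- A nonzero bracket would make the difference of two distinct simple roots a root.
  · by_contra hne
    have hmem' := lie_mem_genWeightSpace_of_mem_genWeightSpace (he i) (hf j)
    let W : Weight K H L := ⟨_, fun h₀ ↦ hne (by rw [h₀] at hmem'; simpa using hmem')⟩
    have hW : (W : H → K) = (i : H.root).1 + -(j : H.root).1 := rfl
    have hW₀ : W.IsNonZero := by
      intro h₀
      refine hij (Subtype.ext (Subtype.ext ?_))
      ext t
      have := congr_fun (hW.symm.trans h₀) t
      simpa [add_neg_eq_zero] using this
    refine b.sub_notMem_range_root i.2 j.2 ⟨⟨W, by simpa using hW₀⟩, ?_⟩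
    ext t
    simpa [sub_eq_add_neg] using congr_fun hW t

end Basis

end LieAlgebra.IsKilling

/-! ### Equal Cartan matrices give isomorphic Lie algebras. -/

namespace LieAlgebra.Basis

open LieSubalgebra Set Function

section Diagonal

variable {ι K L₁ L₂ : Type*} [Finite ι] [Field K] [LieRing L₁] [LieRing L₂]
  [LieAlgebra K L₁] {H₁ : LieSubalgebra K L₁} (b₁ : Basis ι H₁)
  [LieAlgebra K L₂] {H₂ : LieSubalgebra K L₂} (b₂ : Basis ι H₂)

/-- The subalgebra of `L₁ × L₂` generated by the pairs of matching Chevalley generators. -/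
def diagonal : LieSubalgebra K (L₁ × L₂) :=
  lieSpan K _ (range (fun i ↦ (b₁.e i, b₂.e i)) ∪ range fun i ↦ (b₁.f i, b₂.f i))

lemma e_mem_diagonal (i : ι) : (b₁.e i, b₂.e i) ∈ diagonal b₁ b₂ :=
  subset_lieSpan (.inl ⟨i, rfl⟩)

lemma f_mem_diagonal (i : ι) : (b₁.f i, b₂.f i) ∈ diagonal b₁ b₂ :=
  subset_lieSpan (.inr ⟨i, rfl⟩)

lemma h_mem_diagonal (i : ι) : (b₁.h i, b₂.h i) ∈ diagonal b₁ b₂ := by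
  have := lie_mem _ (e_mem_diagonal b₁ b₂ i) (f_mem_diagonal b₁ b₂ i)
  rwa [LieAlgebra.Prod.bracket_apply, (b₁.sl2 i).lie_e_f, (b₂.sl2 i).lie_e_f] at this

lemma swap_mem_diagonal {x : L₁ × L₂} (hx : x ∈ diagonal b₁ b₂) : x.swap ∈ diagonal b₂ b₁ := by
  induction hx using lieSpan_induction with
  | mem u hu =>
    obtain ⟨i, rfl⟩ | ⟨i, rfl⟩ := hu
    · exact e_mem_diagonal b₂ b₁ i
    · exact f_mem_diagonal b₂ b₁ i
  | zero => exact zero_mem _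
  | add u v _ _ hu hv => exact add_mem hu hv
  | smul t u _ hu => exact LieSubalgebra.smul_mem _ t hu
  | lie u v _ _ hu hv => exact lie_mem _ hu hv

lemma exists_mem_diagonal (x : L₁) : ∃ y, (x, y) ∈ diagonal b₁ b₂ := by
  have hx : x ∈ lieSpan K L₁ (range b₁.e ∪ range b₁.f) := by simp [b₁.span_ef]
  induction hx using lieSpan_induction with
  | mem u hu =>
    obtain ⟨i, rfl⟩ | ⟨i, rfl⟩ := hu
    · exact ⟨_, e_mem_diagonal b₁ b₂ i⟩
    · exact ⟨_, f_mem_diagonal b₁ b₂ i⟩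
  | zero => exact ⟨0, zero_mem _⟩
  | add u v _ _ hu hv =>
    obtain ⟨y, hy⟩ := hu
    obtain ⟨z, hz⟩ := hv
    exact ⟨y + z, add_mem hy hz⟩
  | smul t u _ hu =>
    obtain ⟨y, hy⟩ := hu
    exact ⟨t • y, LieSubalgebra.smul_mem _ t hy⟩
  | lie u v _ _ hu hv =>
    obtain ⟨y, hy⟩ := hu
    obtain ⟨z, hz⟩ := hv
    exact ⟨⁅y, z⁆, lie_mem _ hy hz⟩

/-- The Chevalley generators of `LieAlgebra.Basis.diagonal`. -/
def diagonalBasis (hA : b₁.A = b₂.A) :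
    Basis ι (lieSpan K (diagonal b₁ b₂)
      (range fun i ↦ (⟨_, h_mem_diagonal b₁ b₂ i⟩ : diagonal b₁ b₂))) where
  A := b₁.A
  h i := ⟨_, h_mem_diagonal b₁ b₂ i⟩
  e i := ⟨_, e_mem_diagonal b₁ b₂ i⟩
  f i := ⟨_, f_mem_diagonal b₁ b₂ i⟩
  cartan_eq_lieSpan := rfl
  span_ef := by
    refine Eq.trans ?_ (lieSpan_lieSpan_coe_preimage
      (s := range (fun i ↦ (b₁.e i, b₂.e i)) ∪ range fun i ↦ (b₁.f i, b₂.f i)))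
    congr 1
    ext x
    simp only [Subtype.ext_iff, mem_union, mem_range]
    exact Iff.rfl
  linInd := .of_comp (diagonal b₁ b₂).subtype <| .of_comp (LinearMap.fst K L₁ L₂) b₁.linInd
  nondegen := b₁.nondegen
  sl2 i :=
    { h_ne_zero := by simp [Subtype.ext_iff, (b₁.sl2 i).h_ne_zero]
      lie_e_f := by simp [Subtype.ext_iff, (b₁.sl2 i).lie_e_f, (b₂.sl2 i).lie_e_f]
      lie_h_e_nsmul := by
        simp [Subtype.ext_iff, (b₁.sl2 i).lie_h_e_nsmul, (b₂.sl2 i).lie_h_e_nsmul]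
      lie_h_f_nsmul := by
        simp [Subtype.ext_iff, (b₁.sl2 i).lie_h_f_nsmul, (b₂.sl2 i).lie_h_f_nsmul] }
  lie_h_h i j := by simp [Subtype.ext_iff, b₁.lie_h_h, b₂.lie_h_h]
  lie_h_e i j := by simp [Subtype.ext_iff, b₁.lie_h_e, b₂.lie_h_e, ← hA]
  lie_h_f i j := by simp [Subtype.ext_iff, b₁.lie_h_f, b₂.lie_h_f, ← hA]
  lie_e_f_ne i j hij := by simp [Subtype.ext_iff, b₁.lie_e_f_ne i j hij, b₂.lie_e_f_ne i j hij]

variable [CharZero K] [FiniteDimensional K L₁] [FiniteDimensional K L₂]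

/-- The diagonal subalgebra meets the Cartan subalgebra of the second factor trivially, because its
own Cartan subalgebra is the span of the pairs of matching coroots. -/
lemma eq_zero_of_zero_mk_mem_diagonal (hA : b₁.A = b₂.A) {y : L₂} (hy : y ∈ H₂)
    (hy' : ((0 : L₁), y) ∈ diagonal b₁ b₂) : y = 0 := by
  have := Fintype.ofFinite ι
  have hab := b₂.isLieAbelian_cartan
  obtain ⟨C, c, hc⟩ : ∃ (C : LieSubalgebra K (diagonal b₁ b₂)) (c : Basis ι C),
      ∀ i, (c.h i : L₁ × L₂) = (b₁.h i, b₂.h i) :=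
    ⟨_, diagonalBasis b₁ b₂ hA, fun _ ↦ rfl⟩
  have := c.isCartanSubalgebra
  have hspan := c.coe_cartan_eq_span
  -- `(0, y)` commutes with the Cartan subalgebra `C`, so it lies in its zero root space, which is
  -- `C`. Its first component then kills all coefficients.
  have hmem : (⟨_, hy'⟩ : diagonal b₁ b₂) ∈ C := by
    rw [← mem_toLieSubmodule, ← rootSpace_zero_eq, LieModule.mem_genWeightSpace]
    rintro ⟨x, hx⟩
    refine ⟨1, ?_⟩
    suffices ⁅x, (⟨_, hy'⟩ : diagonal b₁ b₂)⁆ = 0 by simpa using! this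
    replace hx : x ∈ Submodule.span K (range c.h) := hspan ▸ hx
    induction hx using Submodule.span_induction with
    | mem u hu =>
      obtain ⟨i, rfl⟩ := hu
      have : ⁅b₂.h i, y⁆ = 0 := congr_arg Subtype.val (trivial_lie_zero H₂ H₂ (b₂.h' i) ⟨y, hy⟩)
      ext1
      change ⁅(c.h i : L₁ × L₂), ((0 : L₁), y)⁆ = 0
      simp [hc, this]
    | zero => simp
    | add u v _ _ hu hv => rw [add_lie, hu, hv, add_zero]
    | smul t u _ hu => rw [smul_lie, hu, smul_zero]
  replace hmem : (⟨_, hy'⟩ : diagonal b₁ b₂) ∈ Submodule.span K (range c.h) := hspan ▸ hmem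
  rw [Submodule.mem_span_range_iff_exists_fun] at hmem
  obtain ⟨a, ha⟩ := hmem
  have h₁ : ∑ i, a i • b₁.h i = 0 := by
    have := congr_arg ((LinearMap.fst K L₁ L₂).comp (diagonal b₁ b₂).toSubmodule.subtype) ha
    simpa [map_sum, hc] using! this
  have h₂ : ∑ i, a i • b₂.h i = y := by
    have := congr_arg ((LinearMap.snd K L₁ L₂).comp (diagonal b₁ b₂).toSubmodule.subtype) ha
    simpa [map_sum, hc] using! this
  have h₃ := Fintype.linearIndependent_iff.mp b₁.linInd a h₁
  simp [← h₂, h₃]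

end Diagonal

section Killing

variable {K L : Type*} [Field K] [CharZero K] [LieRing L] [LieAlgebra K L]
  [IsKilling K L] [FiniteDimensional K L]
  {H : LieSubalgebra K L} [H.IsCartanSubalgebra] [LieModule.IsTriangularizable K H L]

/-- An ideal which meets a Cartan subalgebra trivially is trivial. -/
lemma _root_.LieIdeal.eq_bot_of_forall_mem_cartan (I : LieIdeal K L)
    (hI : ∀ x ∈ I, x ∈ H → x = 0) : I = ⊥ := by
  have h₁ : I.restr H ⊓ H.toLieSubmodule = ⊥ := by
    rw [LieSubmodule.eq_bot_iff]
    rintro x ⟨hx, hx'⟩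
    exact hI x hx hx'
  -- An ideal containing a root space contains the coroot, a nonzero element of `H`.
  have h₂ (α : H.root) : ¬ LieAlgebra.rootSpace H α.val ≤ I.restr H := fun hα ↦ by
    have h₃ : IsKilling.corootSubmodule α.1 ≤ I.restr H := LieIdeal.corootSubmodule_le I hα
    have h₄ := hI _ (h₃ (IsKilling.coe_coroot_mem_corootSubmodule α.1)) (IsKilling.coroot α.1).2
    have h₅ := IsKilling.root_apply_coroot (H.isNonZero_coe_root α)
    simp_all
  have := IsKilling.lieIdeal_eq_inf_cartan_sup_biSup_rootSpace (H := H) I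
  simp only [h₁, h₂, iSup_false, iSup_bot, sup_bot_eq] at this
  rw [LieSubmodule.eq_bot_iff] at this ⊢
  exact this

end Killing

section Equiv

variable {ι K L₁ L₂ : Type*} [Finite ι] [Field K] [CharZero K] [LieRing L₁] [LieRing L₂]
  [LieAlgebra K L₁] [FiniteDimensional K L₁] [IsKilling K L₁]
  {H₁ : LieSubalgebra K L₁} [LieModule.IsTriangularizable K H₁ L₁] (b₁ : Basis ι H₁)
  [LieAlgebra K L₂] [FiniteDimensional K L₂] [IsKilling K L₂]
  {H₂ : LieSubalgebra K L₂} [LieModule.IsTriangularizable K H₂ L₂] (b₂ : Basis ι H₂)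

-- The diagonal projects onto `L₂`, so the elements `y` with `(0, y)` in it form an ideal of `L₂`.
-- This ideal meets `H₂` trivially, hence vanishes.
omit [FiniteDimensional K L₁] [IsKilling K L₁] [LieModule.IsTriangularizable K H₁ L₁] in
lemma eq_of_mk_mem_diagonal [FiniteDimensional K L₁] (hA : b₁.A = b₂.A) {x : L₁} {y z : L₂}
    (hy : (x, y) ∈ diagonal b₁ b₂) (hz : (x, z) ∈ diagonal b₁ b₂) : y = z := by
  have := Fintype.ofFinite ι
  have := b₂.isCartanSubalgebra
  let I : LieIdeal K L₂ :=
    { (diagonal b₁ b₂).toSubmodule.comap (LinearMap.inr K L₁ L₂) with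
      lie_mem := fun {u v} hv ↦ by
        obtain ⟨w, hw⟩ := exists_mem_diagonal b₂ b₁ u
        have := lie_mem _ (swap_mem_diagonal b₂ b₁ hw) hv
        simpa using! this }
  have hI : I = ⊥ := LieIdeal.eq_bot_of_forall_mem_cartan (H := H₂) I fun u hu hu' ↦
    eq_zero_of_zero_mk_mem_diagonal b₁ b₂ hA hu' hu
  have : y - z ∈ I := by
    have := sub_mem hy hz
    rw [Prod.mk_sub_mk, sub_self] at this
    exact this
  rw [hI, LieSubmodule.mem_bot] at this
  exact sub_eq_zero.mp this

/-- Lie algebras with non-degenerate Killing form whose Chevalley generators have the same Cartan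
matrix are isomorphic. -/
theorem exists_equiv (hA : b₁.A = b₂.A) : ∃ φ : L₁ ≃ₗ⁅K⁆ L₂, ∀ i, φ (b₁.h i) = b₂.h i := by
  have h₁ (x : L₁) : ∃! y, (x, y) ∈ diagonal b₁ b₂ := by
    obtain ⟨y, hy⟩ := exists_mem_diagonal b₁ b₂ x
    exact ⟨y, hy, fun z hz ↦ eq_of_mk_mem_diagonal b₁ b₂ hA hz hy⟩
  choose f hf hf' using h₁
  let F : L₁ →ₗ⁅K⁆ L₂ :=
    { toFun := f
      map_add' := fun x y ↦ (hf' _ _ (add_mem (hf x) (hf y))).symm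
      map_smul' := fun t x ↦ (hf' _ _ (LieSubalgebra.smul_mem _ t (hf x))).symm
      map_lie' := fun {x y} ↦ (hf' _ _ (lie_mem _ (hf x) (hf y))).symm }
  have hF : Bijective F := by
    refine ⟨fun x y hxy ↦ ?_, fun y ↦ ?_⟩
    · have h₂ := hf x
      rw [show f x = f y from hxy] at h₂
      exact eq_of_mk_mem_diagonal b₂ b₁ hA.symm (swap_mem_diagonal _ _ h₂)
        (swap_mem_diagonal _ _ (hf y))
    · obtain ⟨x, hx⟩ := exists_mem_diagonal b₂ b₁ y
      exact ⟨x, (hf' _ _ (swap_mem_diagonal _ _ hx)).symm⟩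
  exact ⟨LieEquiv.ofBijective F hF, fun i ↦ (hf' _ _ (h_mem_diagonal b₁ b₂ i)).symm⟩

end Equiv

end LieAlgebra.Basis

/-! ### From a bijection of roots to an isomorphism of Lie algebras. -/

namespace RootPairing

open Set Function

variable {ι ι₂ K M N M₂ N₂ : Type*} [Field K]
  [AddCommGroup M] [Module K M] [AddCommGroup N] [Module K N]
  [AddCommGroup M₂] [Module K M₂] [AddCommGroup N₂] [Module K N₂]

lemma eq_zero_iff_forall_coroot' (P : RootPairing ι K M N) [P.IsRootSystem] (m : M) :
    m = 0 ↔ ∀ i, P.coroot' i m = 0 := by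
  refine ⟨by rintro rfl; simp, fun h ↦ ?_⟩
  rw [← forall_dual_apply_eq_zero_iff K]
  intro f
  have hf : f ∈ Submodule.span K (range P.coroot') := by
    rw [P.span_coroot'_eq_top]; exact Submodule.mem_top
  induction hf using Submodule.span_induction with
  | mem f hf => obtain ⟨i, rfl⟩ := hf; exact h i
  | zero => rfl
  | add f g _ _ hf hg => simp [hf, hg]
  | smul t f _ hf => simp [hf]

/-- A bijection between the roots of two root systems which preserves the pairing is induced by
a linear equivalence. -/
lemma exists_linearEquiv_of_pairing_eq (P : RootPairing ι K M N) [P.IsRootSystem]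
    (Q : RootPairing ι₂ K M₂ N₂) [Q.IsRootSystem] (σ : ι ≃ ι₂)
    (hσ : ∀ i j, Q.pairing (σ i) (σ j) = P.pairing i j) :
    ∃ w : M ≃ₗ[K] M₂, ∀ i, w (P.root i) = Q.root (σ i) := by
  let p := Finsupp.linearCombination K P.root
  let q := Finsupp.linearCombination K (Q.root ∘ σ)
  have hp : Surjective p := by
    rw [← LinearMap.range_eq_top, Finsupp.range_linearCombination]
    exact IsRootSystem.span_root_eq_top
  have hq : Surjective q := by
    rw [← LinearMap.range_eq_top, Finsupp.range_linearCombination, σ.surjective.range_comp]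
    exact IsRootSystem.span_root_eq_top
  -- A linear relation between roots can be tested against coroots, so it depends only on the
  -- pairing.
  have hker : p.ker = q.ker := by
    ext c
    rw [LinearMap.mem_ker, LinearMap.mem_ker, P.eq_zero_iff_forall_coroot',
      Q.eq_zero_iff_forall_coroot', ← σ.forall_congr_right]
    refine forall_congr' fun j ↦ ?_
    simp [p, q, Finsupp.linearCombination_apply, Finsupp.sum, map_sum, hσ]
  refine ⟨(p.quotKerEquivOfSurjective hp).symm.trans
    ((Submodule.quotEquivOfEq _ _ hker).trans (q.quotKerEquivOfSurjective hq)), fun i ↦ ?_⟩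
  have : P.root i = p.quotKerEquivOfSurjective hp (Submodule.Quotient.mk (Finsupp.single i 1)) := by
    simp [p]
  rw [this, LinearEquiv.trans_apply, LinearEquiv.symm_apply_apply]
  simp [q]

/-- The image of a base under a bijection induced by a linear equivalence. -/
lemma Base.exists_map [CharZero K] [Finite ι₂] {P : RootPairing ι K M N} (b : P.Base)
    (Q : RootPairing ι₂ K M₂ N₂) [Q.IsRootSystem] [Q.IsCrystallographic] [Q.IsReduced] (σ : ι ≃ ι₂)
    (w : M ≃ₗ[K] M₂) (hw : ∀ i, w (P.root i) = Q.root (σ i)) :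
    ∃ b' : Q.Base, ∀ i, σ i ∈ b'.support ↔ i ∈ b.support := by
  have himage : w.toAddEquiv '' (P.root '' b.support) = Q.root '' (σ '' b.support) := by
    simp [image_image, hw]
  have hmem {m : M} (hm : m ∈ AddSubmonoid.closure (P.root '' b.support)) :
      w m ∈ AddSubmonoid.closure (Q.root '' (σ '' b.support)) := by
    have := AddSubmonoid.mem_map_of_mem w.toAddEquiv.toAddMonoidHom hm
    rw [AddMonoidHom.map_mclosure] at this
    rw [← himage]
    exact this
  refine ⟨Base.mk' Q (σ '' b.support) ?_ fun i ↦ ?_, fun i ↦ ?_⟩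
  · rw [← linearIndepOn_equiv, show Q.root ∘ σ = w ∘ P.root from funext fun i ↦ (hw i).symm]
    exact LinearIndependent.map' b.linearIndepOn_root w.toLinearMap w.ker
  · obtain ⟨j, rfl⟩ := σ.surjective i
    rw [← hw, ← map_neg]
    exact (b.root_mem_or_neg_mem j).imp hmem hmem
  · simp [Base.mk']

end RootPairing

namespace LieAlgebra

open Set Function

/-- Reindexing of Chevalley generators. -/
@[simps]
def Basis.reindex {ι ι' K L : Type*} [Finite ι] [Finite ι'] [CommRing K] [LieRing L]
    [LieAlgebra K L] {H : LieSubalgebra K L} (b : Basis ι H) (σ : ι' ≃ ι) : Basis ι' H where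
  A := b.A.submatrix σ σ
  h := b.h ∘ σ
  e := b.e ∘ σ
  f := b.f ∘ σ
  cartan_eq_lieSpan := by rw [σ.surjective.range_comp]; exact b.cartan_eq_lieSpan
  span_ef := by rw [σ.surjective.range_comp, σ.surjective.range_comp, b.span_ef]
  linInd := b.linInd.comp σ σ.injective
  nondegen := by
    classical
    have := Fintype.ofFinite ι
    have := Fintype.ofFinite ι'
    rw [Matrix.nondegenerate_iff_det_ne_zero, Matrix.det_submatrix_equiv_self]
    exact b.nondegen.det_ne_zero
  sl2 i := b.sl2 _
  lie_h_h i j := b.lie_h_h _ _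
  lie_h_e i j := b.lie_h_e _ _
  lie_h_f i j := b.lie_h_f _ _
  lie_e_f_ne i j hij := b.lie_e_f_ne _ _ (σ.injective.ne hij)

namespace IsKilling

variable {K L₁ L₂ : Type*} [Field K] [CharZero K] [LieRing L₁] [LieRing L₂]
  [LieAlgebra K L₁] [FiniteDimensional K L₁] [IsKilling K L₁]
  {H₁ : LieSubalgebra K L₁} [H₁.IsCartanSubalgebra] [LieModule.IsTriangularizable K H₁ L₁]
  [LieAlgebra K L₂] [FiniteDimensional K L₂] [IsKilling K L₂]
  {H₂ : LieSubalgebra K L₂} [H₂.IsCartanSubalgebra] [LieModule.IsTriangularizable K H₂ L₂]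

/-- The isomorphism theorem: a bijection between root systems which preserves the pairing is induced
by an isomorphism of Lie algebras. -/
theorem exists_equiv_of_pairing_eq (σ : H₁.root ≃ H₂.root)
    (hσ : ∀ i j, (rootSystem H₂).pairing (σ i) (σ j) = (rootSystem H₁).pairing i j) :
    ∃ φ : L₁ ≃ₗ⁅K⁆ L₂, ∀ i : H₁.root, φ (coroot i.1) = coroot (σ i).1 := by
  obtain ⟨w, hw⟩ := RootPairing.exists_linearEquiv_of_pairing_eq _ _ σ hσ
  obtain ⟨v, hv⟩ := RootPairing.exists_linearEquiv_of_pairing_eq (rootSystem H₁).flip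
    (rootSystem H₂).flip σ fun i j ↦ by simpa using! hσ j i
  obtain ⟨b₁⟩ := (rootSystem H₁).nonempty_base
  obtain ⟨b₂, hb₂⟩ := b₁.exists_map (rootSystem H₂) σ w hw
  obtain ⟨c₁, hA₁, hh₁⟩ := exists_basis b₁
  obtain ⟨c₂, hA₂, hh₂⟩ := exists_basis b₂
  let e : b₁.support ≃ b₂.support := σ.subtypeEquiv fun i ↦ (hb₂ i).symm
  obtain ⟨φ, hφ⟩ := c₁.exists_equiv (c₂.reindex e) <| by
    ext i j
    apply FaithfulSMul.algebraMap_injective ℤ K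
    rw [hA₁, Basis.reindex_A, hA₂, Matrix.submatrix_apply,
      RootPairing.Base.algebraMap_cartanMatrixIn_apply,
      RootPairing.Base.algebraMap_cartanMatrixIn_apply]
    exact (hσ i j).symm
  refine ⟨φ, fun i ↦ ?_⟩
  -- `φ` is known on simple coroots only. There it agrees with the linear map `v`, which is known on
  -- all coroots, and simple coroots span `H₁`.
  have key : φ.toLinearEquiv.toLinearMap ∘ₗ H₁.toSubmodule.subtype =
      H₂.toSubmodule.subtype ∘ₗ v.toLinearMap := by
    refine b₁.toCoweightBasis.ext fun j ↦ ?_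
    have h₁ := hφ j
    rw [hh₁, Basis.reindex_h, comp_apply, hh₂] at h₁
    rw [RootPairing.Base.toCoweightBasis_apply]
    exact h₁.trans (congr_arg Subtype.val (hv j).symm)
  exact (LinearMap.congr_fun key (coroot i.1)).trans (congr_arg Subtype.val (hv i))

end IsKilling

end LieAlgebra

/-! ### Exponentials of derivations. -/

section Analysis

open Set Function Filter Topology

variable {E : Type*} [NormedAddCommGroup E] [NormedSpace ℂ E] [CompleteSpace E]

lemma ContinuousLinearMap.exp_neg_mul_exp (D : E →L[ℂ] E) :
    NormedSpace.exp (-D) * NormedSpace.exp D = 1 := by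
  let := NormedAlgebra.restrictScalars ℚ ℂ (E →L[ℂ] E)
  rw [← NormedSpace.exp_add_of_commute (Commute.neg_left (Commute.refl D)), neg_add_cancel,
    NormedSpace.exp_zero]

/-- The exponential of a derivation of a bilinear product is compatible with the product. -/
lemma ContinuousLinearMap.exp_apply_apply_of_derivation (B : E →L[ℂ] E →L[ℂ] E) (D : E →L[ℂ] E)
    (hD : ∀ x y, D (B x y) = B (D x) y + B x (D y)) (x y : E) :
    NormedSpace.exp D (B x y) = B (NormedSpace.exp D x) (NormedSpace.exp D y) := by
  let G (t : ℂ) : E →L[ℂ] E := NormedSpace.exp (t • D)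
  let G' (t : ℂ) : E →L[ℂ] E := NormedSpace.exp (t • -D)
  let w (t : ℂ) : E := B (G t x) (G t y)
  have hG (t : ℂ) : HasDerivAt G (D * G t) t := hasDerivAt_exp_smul_const' D t
  have hG' (t : ℂ) : HasDerivAt G' (G' t * -D) t := hasDerivAt_exp_smul_const (-D) t
  have hGx (t : ℂ) (z : E) : HasDerivAt (fun t ↦ G t z) (D (G t z)) t := by
    simpa using (hG t).clm_apply (hasDerivAt_const t z)
  have hw (t : ℂ) : HasDerivAt w (D (w t)) t := by
    have h₁ : HasDerivAt (fun t ↦ B (G t x)) (B (D (G t x))) t :=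
      B.hasFDerivAt.comp_hasDerivAt t (hGx t x)
    have := h₁.clm_apply (hGx t y)
    rwa [← hD] at this
  -- `w` solves `u' = D u`, so `exp (-t D) (w t)` is constant; compare `t = 1` with `t = 0`.
  have hf (t : ℂ) : HasDerivAt (fun t ↦ G' t (w t)) 0 t := by
    have := (hG' t).clm_apply (hw t)
    simpa using this
  have h₀ := is_const_of_deriv_eq_zero (fun t ↦ (hf t).differentiableAt) (fun t ↦ (hf t).deriv) 1 0
  have h₁ : NormedSpace.exp (-D) (B (NormedSpace.exp D x) (NormedSpace.exp D y)) = B x y := by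
    simpa [G, G', w, NormedSpace.exp_zero] using h₀
  have h₂ := exp_neg_mul_exp (-D)
  rw [neg_neg] at h₂
  rw [← h₁]
  exact DFunLike.congr_fun h₂ _

/-- If the tangent space at `h` is spanned by a subspace `H` and the infinitesimal orbit of `h`, then
the orbits of the points of `H` near `h` fill up a neighbourhood of `h`. -/
lemma image_exp_apply_mem_nhds [FiniteDimensional ℂ E] (B : E →L[ℂ] E →L[ℂ] E)
    (H : Submodule ℂ E) (h : H) (hH : (B.flip h).range ⊔ H = ⊤) {V : Set H} (hV : V ∈ 𝓝 h) :
    {x : E | ∃ y : E, ∃ z ∈ V, NormedSpace.exp (B y) (z : E) = x} ∈ 𝓝 (h : E) := by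
  have : CompleteSpace H := FiniteDimensional.complete ℂ H
  let Ψ : E × H → E := fun p ↦ NormedSpace.exp (B p.1) (p.2 : E)
  have h₁ : HasStrictFDerivAt (fun p : E × H ↦ NormedSpace.exp (B p.1))
      (B.comp (ContinuousLinearMap.fst ℂ E H)) (0, h) := by
    have h₂ : HasStrictFDerivAt (fun p : E × H ↦ B p.1)
      (B.comp (ContinuousLinearMap.fst ℂ E H)) (0, h) :=
      (B.comp (ContinuousLinearMap.fst ℂ E H)).hasStrictFDerivAt
    have h₃ : HasStrictFDerivAt (NormedSpace.exp : (E →L[ℂ] E) → _)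
        (1 : (E →L[ℂ] E) →L[ℂ] (E →L[ℂ] E)) (B (0 : E)) := by
      rw [map_zero]; exact hasStrictFDerivAt_exp_zero
    exact h₃.comp (0, h) h₂
  have h₂ : HasStrictFDerivAt (fun p : E × H ↦ (p.2 : E))
      (H.subtypeL.comp (ContinuousLinearMap.snd ℂ E H)) (0, h) :=
    (H.subtypeL.comp (ContinuousLinearMap.snd ℂ E H)).hasStrictFDerivAt
  have hΨ := h₁.clm_apply h₂
  -- The derivative at `(0, h)` is `(y, z) ↦ B y h + z`, which is onto by `hH`.
  have hmap := hΨ.map_nhds_eq_of_surj (by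
    rw [eq_top_iff, ← hH, sup_le_iff]
    constructor
    · rintro _ ⟨y, rfl⟩
      exact ⟨(y, 0), by simp⟩
    · intro y hy
      exact ⟨(0, ⟨y, hy⟩), by simp [NormedSpace.exp_zero]⟩)
  have h₃ : NormedSpace.exp (B (0 : E)) (h : E) = h := by simp [NormedSpace.exp_zero]
  rw [h₃] at hmap
  rw [← hmap, mem_map]
  have : univ ×ˢ V ∈ 𝓝 ((0 : E), h) := prod_mem_nhds univ_mem hV
  filter_upwards [this] with p hp
  exact ⟨p.1, p.2, hp.2, rfl⟩

end Analysis

/-! ### Conjugacy of Cartan subalgebras. -/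

namespace LieAlgebra.IsKilling

open Set Function Filter Topology LieModule

section General

variable {K L : Type*} [Field K] [CharZero K] [LieRing L] [LieAlgebra K L]
  [IsKilling K L] [FiniteDimensional K L]

/-- The elements of `H` on which no root vanishes. -/
def regularSet (H : LieSubalgebra K L) [H.IsCartanSubalgebra] : Set H :=
  {h | ∀ α : Weight K H L, α.IsNonZero → α h ≠ 0}

/-- The conjugates under automorphisms of the elements of `H` on which no root vanishes. -/
def conjRegularSet (H : LieSubalgebra K L) [H.IsCartanSubalgebra] : Set L :=
  {x | ∃ φ : L ≃ₗ⁅K⁆ L, ∃ h ∈ regularSet H, φ (h : L) = x}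

variable {H : LieSubalgebra K L} [H.IsCartanSubalgebra] [IsTriangularizable K H L]

omit [IsKilling K L] [IsTriangularizable K H L] in
lemma regularSet_nonempty : (regularSet H).Nonempty := by
  obtain ⟨h, hh⟩ := Module.Dual.exists_forall_ne_zero_of_forall_exists
    (fun α : H.root ↦ (α.1 : H →ₗ[K] K)) fun α ↦ by
      by_contra! h
      exact H.isNonZero_coe_root α (funext h)
  exact ⟨h, fun α hα ↦ hh ⟨α, by simpa using hα⟩⟩

/-- The centralizer of `h` is stable under `H`, hence the sum of its intersections with the root
spaces; on the space of a root `α`, `h` acts by `α h ≠ 0`. -/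
lemma mem_iff_lie_eq_zero_of_mem_regularSet {h : H} (hh : h ∈ regularSet H) (x : L) :
    x ∈ H ↔ ⁅(h : L), x⁆ = 0 := by
  refine ⟨fun hx ↦ congr_arg Subtype.val (trivial_lie_zero H H h ⟨x, hx⟩), fun hx ↦ ?_⟩
  let N : LieSubmodule K H L :=
    { (LieModule.toEnd K L L h).ker with
      lie_mem := fun {t y} hy ↦ by
        replace hy : ⁅(h : L), y⁆ = 0 := hy
        have ht : ⁅(h : L), (t : L)⁆ = 0 := congr_arg Subtype.val (trivial_lie_zero H H h t)
        change ⁅(h : L), ⁅(t : L), y⁆⁆ = 0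
        rw [leibniz_lie, ht, hy, zero_lie, lie_zero, add_zero] }
  have hN : N ≤ H.toLieSubmodule := by
    rw [eq_iSup_inf_genWeightSpace K H L N, iSup_le_iff]
    rintro α y ⟨hy, hyα⟩
    by_cases hα : α.IsZero
    · rw [← rootSpace_zero_eq K L H, ← hα.eq]; exact hyα
    · have h₁ : ⁅(h : L), y⁆ = α h • y := lie_eq_smul_of_mem_rootSpace hyα h
      rw [show ⁅(h : L), y⁆ = 0 from hy, eq_comm, smul_eq_zero] at h₁
      rw [h₁.resolve_left (hh α hα)]
      exact zero_mem _
  exact hN hx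

/-- Cartan subalgebras with conjugate regular elements are conjugate. -/
lemma exists_map_eq_of_conjRegularSet_inter_nonempty {H' : LieSubalgebra K L}
    [H'.IsCartanSubalgebra] [IsTriangularizable K H' L]
    (hne : (conjRegularSet H ∩ conjRegularSet H').Nonempty) :
    ∃ φ : L ≃ₗ⁅K⁆ L, ∀ x, φ x ∈ H' ↔ x ∈ H := by
  obtain ⟨-, ⟨φ, h, hh, rfl⟩, ψ, h', hh', heq⟩ := hne
  refine ⟨φ.trans ψ.symm, fun x ↦ ?_⟩
  rw [mem_iff_lie_eq_zero_of_mem_regularSet hh, mem_iff_lie_eq_zero_of_mem_regularSet hh',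
    show (h' : L) = φ.trans ψ.symm h from (ψ.symm_apply_eq.mpr heq.symm).symm, ← LieEquiv.map_lie]
  exact (φ.trans ψ.symm).toLinearEquiv.map_eq_zero_iff

omit [CharZero K] [IsKilling K L] [FiniteDimensional K L] [IsTriangularizable K H L] in
lemma apply_mem_conjRegularSet (φ : L ≃ₗ⁅K⁆ L) {x : L} (hx : x ∈ conjRegularSet H) :
    φ x ∈ conjRegularSet H := by
  obtain ⟨ψ, h, hh, rfl⟩ := hx
  exact ⟨ψ.trans φ, h, hh, rfl⟩

/-- By symmetry, the sets attached to two Cartan subalgebras are equal or disjoint, as the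
connectedness argument requires. -/
lemma conjRegularSet_subset {H' : LieSubalgebra K L} [H'.IsCartanSubalgebra]
    [IsTriangularizable K H' L] (hne : (conjRegularSet H ∩ conjRegularSet H').Nonempty) :
    conjRegularSet H ⊆ conjRegularSet H' := by
  obtain ⟨φ, hφ⟩ := exists_map_eq_of_conjRegularSet_inter_nonempty hne
  rintro - ⟨ψ, h, hh, rfl⟩
  refine ⟨φ.symm.trans ψ, ⟨φ h, (hφ _).mpr h.2⟩, fun α hα h₀ ↦ ?_, by simp⟩
  obtain ⟨x, hx, hx₀⟩ := α.exists_ne_zero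
  have h₁ : ⁅φ h, x⁆ = 0 := by
    have := lie_eq_smul_of_mem_rootSpace hx ⟨φ h, (hφ _).mpr h.2⟩
    rwa [h₀, zero_smul] at this
  have h₂ : φ.symm x ∈ H := by
    rw [mem_iff_lie_eq_zero_of_mem_regularSet hh]
    apply φ.injective
    simpa using h₁
  have h₃ : x ∈ H' := by simpa using (hφ _).mpr h₂
  rw [← LieSubalgebra.mem_toLieSubmodule, ← rootSpace_zero_eq K L H'] at h₃
  have := (disjoint_genWeightSpace K H' L hα).le_bot ⟨hx, h₃⟩
  exact hx₀ (by simpa using this)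

/-- A regular element lies in a Cartan subalgebra of which it is a regular element. -/
lemma exists_mem_conjRegularSet [IsAlgClosed K] {x : L} (hx : IsRegular K x) :
    ∃ (H : LieSubalgebra K L) (_ : H.IsCartanSubalgebra), x ∈ conjRegularSet H := by
  have hinf : finrank K L ≤ Cardinal.mk K := Cardinal.natCast_le_aleph0.trans
    (Cardinal.infinite_iff.mp (inferInstanceAs (Infinite K)))
  have hC : (LieSubalgebra.engel K x).IsCartanSubalgebra := by
    refine ⟨?_, LieSubalgebra.normalizer_engel _ _⟩
    apply LieSubalgebra.isNilpotent_of_forall_le_engel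
    -- Engel subalgebras have dimension at least the rank, and that of `x` attains it. It is
    -- therefore minimal, hence contained in the Engel subalgebra of each of its elements `y`, which
    -- makes it nilpotent.
    intro y hy
    set Ex : {LieSubalgebra.engel K z | z ∈ LieSubalgebra.engel K x} :=
      ⟨LieSubalgebra.engel K x, x, LieSubalgebra.self_mem_engel _ _, rfl⟩
    suffices IsBot Ex from @this ⟨LieSubalgebra.engel K y, y, hy, rfl⟩
    apply engel_isBot_of_isMin hinf (LieSubalgebra.engel K x) Ex le_rfl
    rintro ⟨_, y, hy, rfl⟩ hyx
    suffices finrank K (LieSubalgebra.engel K x) ≤ finrank K (LieSubalgebra.engel K y) by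
      suffices LieSubalgebra.engel K y = LieSubalgebra.engel K x from this.ge
      apply LieSubalgebra.toSubmodule_injective
      exact Submodule.eq_of_le_of_finrank_le hyx this
    rw [(isRegular_iff_finrank_engel_eq_rank K x).mp hx]
    apply rank_le_finrank_engel
  refine ⟨_, hC, .refl, ⟨x, LieSubalgebra.self_mem_engel _ _⟩, fun α hα h₀ ↦ ?_, rfl⟩
  obtain ⟨y, hy, hy₀⟩ := α.exists_ne_zero
  have h₁ : ⁅x, y⁆ = 0 := by
    have := lie_eq_smul_of_mem_rootSpace hy ⟨x, LieSubalgebra.self_mem_engel _ _⟩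
    rwa [h₀, zero_smul] at this
  have h₂ : y ∈ LieSubalgebra.engel K x := (LieSubalgebra.mem_engel_iff _ _ _).mpr ⟨1, by simpa⟩
  rw [← LieSubalgebra.mem_toLieSubmodule, ← rootSpace_zero_eq K L (LieSubalgebra.engel K x)] at h₂
  have := (disjoint_genWeightSpace K (LieSubalgebra.engel K x) L hα).le_bot ⟨hy, h₂⟩
  exact hy₀ (by simpa using this)

omit [CharZero K] [IsKilling K L] in
/-- On a line through a regular element there are only finitely many elements which are not
regular. -/
lemma finite_setOf_not_isRegular (x v : L) (hx : IsRegular K x) :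
    {t : K | ¬ IsRegular K (x + t • v)}.Finite := by
  classical
  let b := Module.finBasis K L
  obtain ⟨p, hp⟩ : ∃ p : MvPolynomial _ K, ∀ y : L,
      IsRegular K y ↔ MvPolynomial.eval (b.repr y) p ≠ 0 :=
    ⟨_, fun y ↦ isRegular_iff_coeff_polyCharpoly_rank_ne_zero K b y⟩
  let q : Polynomial K := MvPolynomial.aeval
    (fun i ↦ Polynomial.C (b.repr x i) + Polynomial.X * Polynomial.C (b.repr v i)) p
  have hq (t : K) : q.eval t = MvPolynomial.eval (b.repr (x + t • v)) p := by
    have h₁ : (fun i ↦ b.repr x i + t * b.repr v i) = b.repr (x + t • v) := by ext i; simp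
    rw [← Polynomial.coe_aeval_eq_eval, ← AlgHom.comp_apply, MvPolynomial.comp_aeval,
      ← MvPolynomial.coe_aeval_eq_eval, ← h₁]
    have h₂ (i) : Polynomial.aeval t (Polynomial.C (b.repr x i) + Polynomial.X * Polynomial.C (b.repr v i)) =
        b.repr x i + t * b.repr v i := by
      rw [map_add, map_mul, Polynomial.aeval_C, Polynomial.aeval_C, Polynomial.aeval_X]
      rfl
    simp_rw [h₂]
    rfl
  have hq₀ : q ≠ 0 := fun h₀ ↦ by
    rw [hp] at hx
    have := hq 0
    rw [h₀, zero_smul, add_zero, Polynomial.eval_zero] at this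
    exact hx this.symm
  refine q.rootSet_finite K |>.subset fun t ht ↦ ?_
  rw [Set.mem_ofPred_eq, hp, not_not] at ht
  rw [Polynomial.mem_rootSet]
  refine ⟨hq₀, ?_⟩
  rw [Polynomial.coe_aeval_eq_eval, hq]
  exact ht

end General

section Complex

variable {L : Type*} [LieRing L] [LieAlgebra ℂ L] [IsKilling ℂ L] [FiniteDimensional ℂ L]

/-- The set of conjugates of regular elements of a Cartan subalgebra is open. -/
lemma isOpen_setOf_add_smul_mem_conjRegularSet (H : LieSubalgebra ℂ L) [H.IsCartanSubalgebra]
    (a v : L) : IsOpen {t : ℂ | a + t • v ∈ conjRegularSet H} := by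
  -- `L` carries no topology, so a norm is chosen inside the proof; stating openness along a complex
  -- line keeps it out of the statement.
  let F := (Module.finBasis ℂ L).equivFun
  let _ : NormedAddCommGroup L := NormedAddCommGroup.induced L _ F F.injective
  let _ : NormedSpace ℂ L := NormedSpace.induced ℂ L _ F
  have : CompleteSpace L := FiniteDimensional.complete ℂ L
  let B : L →L[ℂ] L →L[ℂ] L := LinearMap.toContinuousLinearMap
    (LinearMap.toContinuousLinearMap.toLinearMap ∘ₗ
      LinearMap.mk₂ ℂ (fun x y : L ↦ ⁅x, y⁆) add_lie smul_lie lie_add fun c x y ↦ lie_smul c x y)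
  have hB (x y : L) : B x y = ⁅x, y⁆ := rfl
  let exp (y : L) : L ≃ₗ⁅ℂ⁆ L :=
    LieEquiv.ofBijective
      { (NormedSpace.exp (B y)).toLinearMap with
        map_lie' := fun {u v} ↦ ContinuousLinearMap.exp_apply_apply_of_derivation B (B y)
          (fun u v ↦ by simp only [hB]; exact leibniz_lie y u v) u v } (by
        have h₁ := ContinuousLinearMap.exp_neg_mul_exp (B y)
        have h₂ := ContinuousLinearMap.exp_neg_mul_exp (-B y)
        rw [neg_neg] at h₂
        exact bijective_iff_has_inverse.mpr ⟨(NormedSpace.exp (-B y) : L →L[ℂ] L),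
          fun x ↦ DFunLike.congr_fun h₁ x, fun x ↦ DFunLike.congr_fun h₂ x⟩)
  have hopen : IsOpen (regularSet H) := by
    have : regularSet H = ⋂ α : H.root, {h | α.1 h ≠ 0} := by
      ext h
      simp [regularSet]
    rw [this]
    refine isOpen_iInter_of_finite fun α ↦ ?_
    have : Continuous α.1 := (α.1.toLinear).continuous_of_finiteDimensional
    exact isOpen_ne_fun this continuous_const
  have hnhds (h : H) (hh : h ∈ regularSet H) : conjRegularSet H ∈ 𝓝 (h : L) := by
    have hH : (B.flip h).range ⊔ H.toSubmodule = ⊤ := by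
      rw [eq_top_iff, ← LieSubmodule.top_toSubmodule (R := ℂ) (L := H),
        ← cartan_sup_iSup_rootSpace_eq_top H]
      simp only [LieSubmodule.sup_toSubmodule, LieSubmodule.iSup_toSubmodule, sup_le_iff,
        iSup_le_iff]
      refine ⟨le_sup_right, fun α hα ↦ le_sup_of_le_left fun x hx ↦ ⟨-(α h)⁻¹ • x, ?_⟩⟩
      have h₁ : ⁅(h : L), x⁆ = α h • x := lie_eq_smul_of_mem_rootSpace hx h
      have h₂ : ⁅x, (h : L)⁆ = -(α h • x) := by rw [← h₁, lie_skew]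
      change ⁅-(α h)⁻¹ • x, (h : L)⁆ = x
      rw [smul_lie, h₂, smul_neg, neg_smul, neg_neg, smul_smul, inv_mul_cancel₀ (hh α hα), one_smul]
    filter_upwards [image_exp_apply_mem_nhds B H.toSubmodule h hH (hopen.mem_nhds hh)]
    rintro - ⟨y, z, hz, rfl⟩
    exact ⟨exp y, z, hz, rfl⟩
  have hconj : IsOpen (conjRegularSet H) := by
    rw [isOpen_iff_mem_nhds]
    rintro - ⟨φ, h, hh, rfl⟩
    have hφ : Continuous φ.symm := φ.symm.toLinearEquiv.toLinearMap.continuous_of_finiteDimensional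
    have := hφ.continuousAt (x := φ h) (by simpa using hnhds h hh)
    filter_upwards [this] with x hx
    simpa using apply_mem_conjRegularSet φ hx
  exact hconj.preimage (by fun_prop)

/-- On a line joining a regular element to a point of `regularSet H`, the parameters landing in
`conjRegularSet H` form a nonempty open, hence infinite, set, while only finitely many points are
not regular. -/
lemma exists_isRegular_mem_conjRegularSet (H : LieSubalgebra ℂ L) [H.IsCartanSubalgebra] :
    ∃ x ∈ conjRegularSet H, IsRegular ℂ x := by
  obtain ⟨x, hx⟩ := exists_isRegular ℂ L
  obtain ⟨h, hh⟩ := regularSet_nonempty (H := H)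
  have h₁ := (isOpen_setOf_add_smul_mem_conjRegularSet H x (h - x)).mem_nhds (x := 1)
    ⟨.refl, h, hh, by simp⟩
  have h₂ := infinite_of_mem_nhds (1 : ℂ) h₁
  obtain ⟨t, ht, ht'⟩ := (h₂.sdiff (finite_setOf_not_isRegular x (h - x) hx)).nonempty
  exact ⟨_, ht, not_not.mp ht'⟩

/-- Any two Cartan subalgebras of a semisimple complex Lie algebra are conjugate. -/
theorem exists_equiv_forall_mem_iff (H H' : LieSubalgebra ℂ L) [H.IsCartanSubalgebra]
    [H'.IsCartanSubalgebra] : ∃ φ : L ≃ₗ⁅ℂ⁆ L, ∀ x, φ x ∈ H' ↔ x ∈ H := by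
  refine exists_map_eq_of_conjRegularSet_inter_nonempty ?_
  by_contra hne
  obtain ⟨x, hx, hxr⟩ := exists_isRegular_mem_conjRegularSet H
  obtain ⟨y, hy, hyr⟩ := exists_isRegular_mem_conjRegularSet H'
  let T := {t : ℂ | ¬ IsRegular ℂ (x + t • (y - x))}ᶜ
  have hT : IsPreconnected T := by
    refine ((finite_setOf_not_isRegular x (y - x) hxr).countable.isConnected_compl_of_one_lt_rank
      ?_).isPreconnected
    simp
  let U := {t : ℂ | x + t • (y - x) ∈ conjRegularSet H}
  -- `U` and `V` cover `T` because a regular element lies in the set of some Cartan subalgebra; they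
  -- are disjoint by the choice of `V`.
  let V := ⋃ (C : LieSubalgebra ℂ L) (_ : C.IsCartanSubalgebra)
    (_ : ¬ (conjRegularSet C ∩ conjRegularSet H).Nonempty),
      {t : ℂ | x + t • (y - x) ∈ conjRegularSet C}
  obtain ⟨t, -, htU, htV⟩ := hT U V (isOpen_setOf_add_smul_mem_conjRegularSet H _ _)
    (isOpen_iUnion fun C ↦ isOpen_iUnion fun _ ↦ isOpen_iUnion fun _ ↦
      isOpen_setOf_add_smul_mem_conjRegularSet C _ _)
    (fun t ht ↦ by
      obtain ⟨C, hC, htC⟩ := exists_mem_conjRegularSet (not_not.mp ht)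
      by_cases h : (conjRegularSet C ∩ conjRegularSet H).Nonempty
      · exact .inl (conjRegularSet_subset h htC)
      · exact .inr (mem_iUnion₂_of_mem hC (mem_iUnion_of_mem h htC)))
    ⟨0, by simpa [T] using hxr, by simpa [U] using hx⟩
    ⟨1, by simpa [T] using hyr, by
      refine mem_iUnion₂_of_mem ‹H'.IsCartanSubalgebra› (mem_iUnion_of_mem ?_ ?_)
      · rwa [inter_comm]
      · simpa using hy⟩
  simp only [V, mem_iUnion] at htV
  obtain ⟨C, hC, hC', htC⟩ := htV
  exact hC' ⟨_, htC, htU⟩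

end Complex

end LieAlgebra.IsKilling

/-! ### Symmetry of the pairing for simple ADE algebras. -/

namespace RootPairing

variable {ι K M N : Type*} [Field K] [CharZero K] [Finite ι] [AddCommGroup M] [Module K M]
  [AddCommGroup N] [Module K N] {P : RootPairing ι K M N} [P.IsCrystallographic]
  [P.IsReduced] [P.IsRootSystem]

/-- If the Cartan matrix of a base is symmetric, then the pairing of any two roots is symmetric. -/
lemma Base.pairing_comm_of_isSymm (b : P.Base) (hb : b.cartanMatrix.IsSymm) (i j : ι) :
    P.pairing i j = P.pairing j i := by
  have h₀ (i j : b.support) : P.pairing i j = P.pairing j i := by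
    have := congrArg (algebraMap ℤ K) (hb.apply i j)
    rwa [b.algebraMap_cartanMatrixIn_apply ℤ, b.algebraMap_cartanMatrixIn_apply ℤ, eq_comm] at this
  let T : M →ₗ[K] N := b.toWeightBasis.constr K fun i ↦ P.coroot i
  have hT (i : b.support) : T (P.root i) = P.coroot i := by
    rw [← b.toWeightBasis_apply, b.toWeightBasis.constr_basis]
  have h₁ (j : b.support) (x : M) : P.toLinearMap x (P.coroot j) = P.toLinearMap (P.root j) (T x) := by
    have : P.toLinearMap.flip (P.coroot j) = P.toLinearMap (P.root j) ∘ₗ T :=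
      b.toWeightBasis.ext fun i ↦ by simp [hT, h₀ i j]
    exact LinearMap.congr_fun this x
  -- By `h₁`, `T` is compatible with simple reflections, so it maps every root, not only the simple
  -- ones, to its coroot.
  have h₂ (i : ι) : T (P.root i) = P.coroot i := by
    refine b.induction_reflect i (p := fun i ↦ T (P.root i) = P.coroot i)
      (fun i hi ↦ ?_) (fun i hi ↦ hT ⟨i, hi⟩) fun i j hi hj ↦ ?_
    · simp [hi]
    · have : P.pairing i j = P.pairing j i := by
        simpa [hi] using h₁ ⟨j, hj⟩ (P.root i)
      rw [root_reflectionPerm, coroot_reflectionPerm, reflection_apply_root, coreflection_apply_coroot,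
        map_sub, map_smul, hi, hT ⟨j, hj⟩, this]
  have h₃ : P.toLinearMap.compl₂ T = (P.toLinearMap.compl₂ T).flip :=
    b.toWeightBasis.ext fun i ↦ b.toWeightBasis.ext fun j ↦ by simp [h₂, h₀ i j]
  simpa [h₂] using LinearMap.congr_fun₂ h₃ (P.root i) (P.root j)

end RootPairing

lemma ReductiveLie.IsADECartanMatrix.isSymm {ι : Type*} {M : Matrix ι ι ℤ}
    (h : ReductiveLie.IsADECartanMatrix M) : M.IsSymm := by
  have key {n : ℕ} {N : Matrix (Fin n) (Fin n) ℤ} (hN : N.IsSymm) (f : ι ≃ Fin n)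
      (hf : M.reindex f f = N) : M.IsSymm := by
    ext i j
    subst hf
    simpa using hN.apply (f i) (f j)
  obtain ⟨n, -, f, hf⟩ | ⟨n, -, f, hf⟩ | ⟨f, hf⟩ | ⟨f, hf⟩ | ⟨f, hf⟩ := h
  · exact key (CartanMatrix.A_isSymm n) f hf
  · exact key (CartanMatrix.D_isSymm n) f hf
  · exact key CartanMatrix.E₆_isSymm f hf
  · exact key CartanMatrix.E₇_isSymm f hf
  · exact key CartanMatrix.E₈_isSymm f hf

namespace LieAlgebra.IsKilling

variable {K L : Type*} [Field K] [CharZero K] [LieRing L] [LieAlgebra K L] [IsKilling K L]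
  [FiniteDimensional K L]

/-- An isomorphism which maps a splitting Cartan subalgebra to another one identifies roots
and coroots. -/
lemma exists_root_comap (φ : L ≃ₗ⁅K⁆ L) {H H' : LieSubalgebra K L} [H.IsCartanSubalgebra]
    [H'.IsCartanSubalgebra] [LieModule.IsTriangularizable K H L] [LieModule.IsTriangularizable K H' L]
    (h : ∀ x, φ x ∈ H' ↔ x ∈ H) (α : H'.root) :
    ∃ β : H.root, (∀ x : H, β.1 x = α.1 ⟨φ x, (h x).mpr x.2⟩) ∧
      φ (coroot β.1 : L) = coroot α.1 := by
  have hα := H'.isNonZero_coe_root α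
  obtain ⟨t, e, f, ht, he, hf⟩ := exists_isSl2Triple_of_weight_isNonZero hα
  let γ : H → K := fun y ↦ α.1 ⟨φ y, (h y).mpr y.2⟩
  have he' : φ.symm e ∈ rootSpace H γ := mem_rootSpace_of_forall_lie_eq fun y ↦ by
    apply φ.injective
    simpa using lie_eq_smul_of_mem_rootSpace he ⟨φ y, (h y).mpr y.2⟩
  have hf' : φ.symm f ∈ rootSpace H (-γ) := mem_rootSpace_of_forall_lie_eq fun y ↦ by
    apply φ.injective
    simpa [γ] using lie_eq_smul_of_mem_rootSpace hf ⟨φ y, (h y).mpr y.2⟩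
  have ht' : IsSl2Triple (φ.symm t) (φ.symm e) (φ.symm f) :=
    { h_ne_zero := by simpa using ht.h_ne_zero
      lie_e_f := by rw [← LieEquiv.map_lie, ht.lie_e_f]
      lie_h_e_nsmul := by rw [← LieEquiv.map_lie, ht.lie_h_e_nsmul, map_nsmul]
      lie_h_f_nsmul := by rw [← LieEquiv.map_lie, ht.lie_h_f_nsmul, map_neg, map_nsmul] }
  let β : LieModule.Weight K H L := ⟨γ, fun h₀ ↦ by
    rw [rootSpace, h₀, LieSubmodule.mem_bot] at he'
    exact ht.e_ne_zero (by simpa using he')⟩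
  have hβ : β.IsNonZero := fun h₀ ↦ hα <| by
    ext y
    have hy := (h (φ.symm y)).mp (by simp)
    have : γ ⟨φ.symm y, hy⟩ = 0 := congrFun h₀ ⟨φ.symm y, hy⟩
    simpa [γ] using this
  refine ⟨⟨β, by simpa using hβ⟩, fun x ↦ rfl, ?_⟩
  rw [← ht.h_eq_coroot hα he hf]
  change φ (coroot β : L) = t
  rw [← ht'.h_eq_coroot hβ he' hf', LieEquiv.apply_symm_apply]

end LieAlgebra.IsKilling

namespace ReductiveLie

open LieAlgebra.IsKilling (exists_equiv_forall_mem_iff exists_root_comap rootSystem_pairing_apply)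

/-- A simple Lie algebra of type ADE is simply laced with respect to every Cartan subalgebra. -/
lemma IsSimpleOfTypeADE.pairing_comm {L : Type*} [LieRing L] [LieAlgebra ℂ L]
    [FiniteDimensional ℂ L] [LieAlgebra.IsKilling ℂ L] (hL : IsSimpleOfTypeADE L)
    (H : LieSubalgebra ℂ L) [H.IsCartanSubalgebra] (α β : H.root) :
    α.1 (LieAlgebra.IsKilling.coroot β.1) = β.1 (LieAlgebra.IsKilling.coroot α.1) := by
  obtain ⟨_, H', _, b, hb⟩ := hL
  obtain ⟨φ, hφ⟩ := exists_equiv_forall_mem_iff H' H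
  obtain ⟨α', h₁, h₂⟩ := exists_root_comap φ hφ α
  obtain ⟨β', h₃, h₄⟩ := exists_root_comap φ hφ β
  have h := b.pairing_comm_of_isSymm hb.isSymm α' β'
  rw [rootSystem_pairing_apply, rootSystem_pairing_apply, h₁, h₃] at h
  simpa only [h₂, h₄] using h

end ReductiveLie

/-! ### Direct factors and the structure of reductive Lie algebras. -/

namespace LieIdeal

variable {K L : Type*} [Field K] [LieRing L] [LieAlgebra K L]

/-- The projection of a Lie algebra onto an ideal along a complementary ideal. -/
def projection {I J : LieIdeal K L} (h : IsCompl I J) : L →ₗ⁅K⁆ I :=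
  { Submodule.projectionOnto I.toSubmodule J.toSubmodule (LieSubmodule.isCompl_toSubmodule.mpr h) with
    map_lie' := fun {x y} ↦ by
      have h' := LieSubmodule.isCompl_toSubmodule.mpr h
      have key (x : L) : ∃ a ∈ I, ∃ b ∈ J, a + b = x :=
        LieSubmodule.mem_sup _ _ _ |>.mp (h.sup_eq_top ▸ LieSubmodule.mem_top x)
      obtain ⟨a, ha, b, hb, rfl⟩ := key x
      obtain ⟨c, hc, d, hd, rfl⟩ := key y
      have h₁ {a b : L} (ha : a ∈ I) (hb : b ∈ J) : Submodule.projectionOnto _ _ h' (a + b) = ⟨a, ha⟩ := by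
        rw [map_add, (Submodule.projectionOnto_apply_eq_zero_iff h').mpr hb, add_zero]
        exact Submodule.projectionOnto_apply_left h' ⟨a, ha⟩
      have h₂ {a b : L} (ha : a ∈ I) (hb : b ∈ J) : ⁅a, b⁆ = 0 := by
        have : ⁅a, b⁆ ∈ I ⊓ J := ⟨lie_mem_left K L I a b ha, lie_mem_right K L J a b hb⟩
        simpa [h.inf_eq_bot] using this
      have h₃ : ⁅a + b, c + d⁆ = ⁅a, c⁆ + ⁅b, d⁆ := by
        rw [add_lie, lie_add, lie_add, h₂ ha hd, ← lie_skew b c, h₂ hc hb]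
        simp
      let p : L → I := Submodule.projectionOnto _ _ h'
      change p ⁅a + b, c + d⁆ = ⁅p (a + b), p (c + d)⁆
      rw [h₃]
      exact (h₁ (lie_mem_left K L I a c ha) (lie_mem_left K L J b d hb)).trans
        (congrArg₂ (fun x y : I ↦ ⁅x, y⁆) (h₁ ha hb) (h₁ hc hd)).symm }

lemma projection_apply_of_mem_left {I J : LieIdeal K L} (h : IsCompl I J) (x : I) :
    projection h x = x :=
  Submodule.projectionOnto_apply_left (LieSubmodule.isCompl_toSubmodule.mpr h) x

lemma projection_apply_eq_zero_iff {I J : LieIdeal K L} (h : IsCompl I J) {x : L} :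
    projection h x = 0 ↔ x ∈ J :=
  Submodule.projectionOnto_apply_eq_zero_iff (LieSubmodule.isCompl_toSubmodule.mpr h)

end LieIdeal

section Retract

variable {K L : Type*} [Field K] [LieRing L] [LieAlgebra K L] {I : LieIdeal K L}
  {π : L →ₗ⁅K⁆ I} (hπ : ∀ x : I, π x = x)

include hπ

namespace LieIdeal

lemma lie_coe_eq_of_retract (x : L) (y : I) : ⁅x, (y : L)⁆ = (⁅π x, y⁆ : I) := by
  have : ⁅x, (y : L)⁆ = (⁅x, y⁆ : I) := rfl
  rw [this, ← hπ ⁅x, y⁆, ← this, LieHom.map_lie, hπ]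

lemma retract_lie_eq (x y : L) : (π ⁅x, y⁆ : L) = ⁅x, (π y : L)⁆ := by
  rw [lie_coe_eq_of_retract hπ, LieHom.map_lie]

/-- `π` commutes with the action of `H`, so it preserves the zero root subalgebra, which is `H`. -/
lemma coe_retract_mem_of_isCartanSubalgebra [IsNoetherian K L] (H : LieSubalgebra K L)
    [H.IsCartanSubalgebra] {x : L} (hx : x ∈ H) : (π x : L) ∈ H := by
  rw [← LieAlgebra.zeroRootSubalgebra_eq_of_is_cartan K L H, LieAlgebra.mem_zeroRootSubalgebra] at hx ⊢
  intro y
  obtain ⟨k, hk⟩ := hx y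
  use k
  have (k : ℕ) : ((LieModule.toEnd K H L y) ^ k) (π x) = π (((LieModule.toEnd K H L y) ^ k) x) := by
    induction k with
    | zero => simp
    | succ k ih =>
      rw [pow_succ', Module.End.mul_apply, Module.End.mul_apply, ih]
      exact (retract_lie_eq hπ _ _).symm
  rw [this, hk, map_zero, LieSubmodule.coe_zero]

/-- The intersection of a Cartan subalgebra with a direct factor is a Cartan subalgebra. -/
lemma isCartanSubalgebra_comap_incl [IsNoetherian K L] (H : LieSubalgebra K L)
    [H.IsCartanSubalgebra] : (H.comap I.incl).IsCartanSubalgebra where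
  nilpotent := by
    let f : H.comap I.incl →ₗ⁅K⁆ H :=
      { toFun := fun x ↦ ⟨(x : I), x.2⟩
        map_add' := fun _ _ ↦ rfl
        map_smul' := fun _ _ ↦ rfl
        map_lie' := rfl }
    refine Function.Injective.lieAlgebra_isNilpotent (f := f) fun x y hxy ↦ ?_
    ext
    exact congrArg (fun z : H ↦ (z : L)) hxy
  self_normalizing := by
    refine le_antisymm (fun x hx ↦ ?_) (LieSubalgebra.le_normalizer _)
    rw [LieSubalgebra.mem_normalizer_iff] at hx
    change (x : L) ∈ H
    rw [← LieSubalgebra.IsCartanSubalgebra.self_normalizing (H := H), LieSubalgebra.mem_normalizer_iff]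
    intro y hy
    have h₁ := hx (π y) (coe_retract_mem_of_isCartanSubalgebra hπ H hy)
    have h₂ := lie_coe_eq_of_retract hπ y x
    rw [← lie_skew, h₂]
    simpa using h₁

/-- `y - π y` lies in the kernel of `π`, so its brackets do too and are killed by `ad x`; hence it
does not contribute to the trace. -/
lemma killingForm_coe_apply [FiniteDimensional K L] (x : I) (y : L) :
    killingForm K L x y = killingForm K I x (π y) := by
  rw [LieIdeal.killingForm_eq]
  change _ = killingForm K L x (π y)
  have : LieModule.toEnd K L L (x : L) ∘ₗ LieModule.toEnd K L L (y - π y) = 0 := by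
    ext z
    change ⁅(x : L), ⁅y - π y, z⁆⁆ = 0
    rw [← lie_skew, lie_coe_eq_of_retract hπ, LieHom.map_lie, map_sub, hπ]
    simp
  rw [← sub_eq_zero, ← map_sub, killingForm_apply_apply]
  exact congrArg (LinearMap.trace K L) this |>.trans (map_zero _)

end LieIdeal

end Retract

namespace ReductiveLie

/-- `Z` is the radical `R`. A complement of `⁅R, R⁆` shows that `⁅R, R⁆` is perfect, hence zero by
solvability. A complement of `R` commutes with `R`, and an abelian ideal of it is an ideal of `L`,
so it lies in `R` and vanishes. -/
lemma IsReductive.exists_isCompl {L : Type*} [LieRing L] [LieAlgebra ℂ L] [FiniteDimensional ℂ L]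
    (h : IsReductive L) : ∃ Z S : LieIdeal ℂ L, IsCompl S Z ∧ (∀ z ∈ Z, ∀ x : L, ⁅x, z⁆ = 0) ∧
      LieAlgebra.IsKilling ℂ S := by
  set R := LieAlgebra.radical ℂ L with hR
  have hRab : ⁅R, R⁆ = ⊥ := by
    obtain ⟨T, hT⟩ := h ⁅R, R⁆
    have h₁ : R = ⁅R, R⁆ ⊔ R ⊓ T := by
      rw [inf_comm, ← sup_inf_assoc_of_le T (LieSubmodule.lie_le_right R R), hT.sup_eq_top,
        top_inf_eq]
    have h₂ : ⁅R ⊓ T, R⁆ = ⊥ := by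
      rw [eq_bot_iff, ← hT.inf_eq_bot]
      refine le_inf (LieSubmodule.mono_lie_left R inf_le_left) ?_
      exact (LieSubmodule.mono_lie_left R inf_le_right).trans (LieSubmodule.lie_le_left T R)
    have h₃ : ⁅R, R⁆ ≤ ⁅⁅R, R⁆, ⁅R, R⁆⁆ := by
      have h₄ : ⁅R, R⁆ = ⁅⁅R, R⁆, R⁆ := by
        conv_lhs => rw [h₁, LieSubmodule.sup_lie, ← h₁, h₂, sup_bot_eq]
      have h₅ : ⁅⁅R, R⁆, R ⊓ T⁆ = ⊥ := by
        rw [eq_bot_iff, ← h₂, LieSubmodule.lie_comm]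
        exact LieSubmodule.mono_lie_right _ (LieSubmodule.lie_le_right R R)
      conv_lhs => rw [h₄]
      conv_lhs => arg 2; rw [h₁]
      rw [LieSubmodule.lie_sup, h₅, sup_bot_eq]
    have h₄ (k : ℕ) : ⁅R, R⁆ ≤ LieAlgebra.derivedSeriesOfIdeal ℂ L k R := by
      induction k with
      | zero => exact LieSubmodule.lie_le_right R R
      | succ k ih =>
        rw [LieAlgebra.derivedSeriesOfIdeal_succ]
        exact h₃.trans (LieSubmodule.mono_lie ih ih)
    obtain ⟨k, hk⟩ := (LieAlgebra.isSolvable_iff ℂ R).mp inferInstance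
    rw [LieIdeal.derivedSeries_eq_bot_iff] at hk
    exact eq_bot_iff.mpr ((h₄ k).trans_eq hk)
  obtain ⟨Q, hQ⟩ := h R
  have hπ := LieIdeal.projection_apply_of_mem_left hQ.symm
  refine ⟨R, Q, hQ.symm, fun z hz x ↦ ?_, ?_⟩
  · obtain ⟨a, ha, b, hb, rfl⟩ := (LieSubmodule.mem_sup _ _ x).mp
      (hQ.sup_eq_top ▸ LieSubmodule.mem_top x)
    have h₁ : ⁅b, z⁆ ∈ R ⊓ Q := ⟨lie_mem_right ℂ L R b z hz, lie_mem_left ℂ L Q b z hb⟩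
    rw [hQ.inf_eq_bot, LieSubmodule.mem_bot] at h₁
    rw [add_lie, h₁, (LieSubmodule.lie_eq_bot_iff R R).mp hRab a ha z hz, add_zero]
  · suffices LieAlgebra.HasTrivialRadical ℂ Q from inferInstance
    rw [LieAlgebra.hasTrivialRadical_iff_no_abelian_ideals]
    intro J hJ
    let J' : LieIdeal ℂ L :=
      { J.toSubmodule.map Q.toSubmodule.subtype with
        lie_mem := by
          rintro x _ ⟨y, hy, rfl⟩
          exact ⟨_, lie_mem_right ℂ Q J (LieIdeal.projection hQ.symm x) y hy,
            (LieIdeal.lie_coe_eq_of_retract hπ x y).symm⟩ }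
    have hJ' : IsLieAbelian J' := by
      rw [LieSubmodule.lie_abelian_iff_lie_self_eq_bot, LieSubmodule.lie_eq_bot_iff]
      rintro _ ⟨x, hx, rfl⟩ _ ⟨y, hy, rfl⟩
      have := trivial_lie_zero J J ⟨x, hx⟩ ⟨y, hy⟩
      exact congrArg (fun z : J ↦ ((z : Q) : L)) this
    have hJR : J' ≤ R := (LieAlgebra.LieIdeal.solvable_iff_le_radical ℂ L J').mp inferInstance
    rw [eq_bot_iff]
    intro x hx
    have : (x : L) ∈ R ⊓ Q := ⟨hJR ⟨x, hx, rfl⟩, x.2⟩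
    rw [hQ.inf_eq_bot, LieSubmodule.mem_bot] at this
    simpa using this

end ReductiveLie

/-! ### Roots and coroots of a reductive Lie algebra. -/

namespace ReductiveLie

open LieAlgebra LieModule

section Retract

variable {L : Type*} [LieRing L] [LieAlgebra ℂ L] [FiniteDimensional ℂ L] {I : LieIdeal ℂ L}
  {π : L →ₗ⁅ℂ⁆ I} (hπ : ∀ x : I, π x = x) (H : LieSubalgebra ℂ L) [H.IsCartanSubalgebra]

/-- The projection of a Cartan subalgebra onto its intersection with a direct factor. -/
def cartanRetract : H →ₗ[ℂ] H.comap I.incl where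
  toFun x := ⟨π x, LieIdeal.coe_retract_mem_of_isCartanSubalgebra hπ H x.2⟩
  map_add' x y := by ext; simp
  map_smul' c x := by ext; simp

@[simp]
lemma coe_cartanRetract_apply (x : H) : (cartanRetract hπ H x : I) = π x := rfl

omit [FiniteDimensional ℂ L] [H.IsCartanSubalgebra] in
variable (I) in
/-- The inclusion of the intersection of a Cartan subalgebra with a direct factor. -/
def cartanIncl : H.comap I.incl →ₗ[ℂ] H where
  toFun x := ⟨(x : I), x.2⟩
  map_add' _ _ := rfl
  map_smul' _ _ := rfl

omit [FiniteDimensional ℂ L] [H.IsCartanSubalgebra] in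
@[simp]
lemma coe_cartanIncl_apply (x : H.comap I.incl) : (cartanIncl I H x : L) = (x : I) := rfl

@[simp]
lemma cartanRetract_cartanIncl (x : H.comap I.incl) :
    cartanRetract hπ H (cartanIncl I H x) = x := by
  ext
  simp [hπ]

variable [IsKilling ℂ I] [(H.comap I.incl).IsCartanSubalgebra]

omit [IsKilling ℂ I] in
/-- A linear form with a root vector in a direct factor comes from a root of this factor. -/
lemma exists_root_of_mem {α : Dual ℂ H} (hα : α ≠ 0) {x : I} (hx : x ≠ 0)
    (h : ∀ t : H, ⁅(t : L), (x : L)⁆ = α t • (x : L)) :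
    ∃ β : (H.comap I.incl).root, α = β.1.toLinear ∘ₗ cartanRetract hπ H := by
  let β : H.comap I.incl → ℂ := fun t ↦ α (cartanIncl I H t)
  have h₁ (t : H) : α t = β (cartanRetract hπ H t) := by
    have h₂ := h (cartanIncl I H (cartanRetract hπ H t))
    rw [coe_cartanIncl_apply, coe_cartanRetract_apply] at h₂
    have h₃ := h t
    rw [LieIdeal.lie_coe_eq_of_retract hπ] at h₂ h₃
    rw [hπ, h₃] at h₂
    exact smul_left_injective ℂ (by simpa using hx) h₂
  let β' : Weight ℂ (H.comap I.incl) I := ⟨β, fun h₀ ↦ by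
    have : x ∈ rootSpace (H.comap I.incl) β := IsKilling.mem_rootSpace_of_forall_lie_eq fun t ↦ by
      ext
      exact h (cartanIncl I H t)
    rw [rootSpace, h₀] at this
    exact hx (by simpa using this)⟩
  have hβ' : β'.IsNonZero := fun h₀ ↦ hα <| by
    ext t
    rw [h₁]
    exact congrFun h₀ _
  exact ⟨⟨β', by simpa using hβ'⟩, LinearMap.ext h₁⟩

lemma comp_cartanRetract_mem_roots (β : (H.comap I.incl).root) :
    β.1.toLinear ∘ₗ cartanRetract hπ H ∈ roots H := by
  have hβ := (H.comap I.incl).isNonZero_coe_root β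
  refine ⟨fun h₀ ↦ hβ ?_, ?_⟩
  · ext t
    simpa using LinearMap.congr_fun h₀ (cartanIncl I H t)
  · obtain ⟨x, hx, hx₀⟩ := β.1.exists_ne_zero
    refine ⟨x, by simpa using hx₀, fun t ↦ ?_⟩
    rw [LieIdeal.lie_coe_eq_of_retract hπ]
    exact congrArg Subtype.val (IsKilling.lie_eq_smul_of_mem_rootSpace hx (cartanRetract hπ H t))

lemma isCorootOf_comp_cartanRetract (β : (H.comap I.incl).root) :
    IsCorootOf H (β.1.toLinear ∘ₗ cartanRetract hπ H) (cartanIncl I H (IsKilling.coroot β.1)) := by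
  have hβ := (H.comap I.incl).isNonZero_coe_root β
  constructor
  · obtain ⟨h, e, f, ht, he, hf⟩ := IsKilling.exists_isSl2Triple_of_weight_isNonZero hβ
    rw [coe_cartanIncl_apply, ← ht.h_eq_coroot hβ he hf, ← ht.lie_e_f]
    exact LieSubmodule.lie_mem_lie (LieSubmodule.mem_top (e : L)) (LieSubmodule.mem_top (f : L))
  · intro x
    have key (x : H) : killingForm ℂ L x (cartanIncl I H (IsKilling.coroot β.1)) =
        2 • (β.1 ((IsKilling.cartanEquivDual (H.comap I.incl)).symm β.1))⁻¹ •
          β.1 (cartanRetract hπ H x) := by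
      rw [← IsKilling.traceForm_coroot, ← traceForm_comm, coe_cartanIncl_apply,
        LieIdeal.killingForm_coe_apply hπ]
      rfl
    have h₁ := IsKilling.root_apply_cartanEquivDual_symm_ne_zero hβ
    rw [key, key, cartanRetract_cartanIncl, IsKilling.root_apply_coroot hβ]
    simp only [LinearMap.comp_apply, Weight.toLinear_apply, nsmul_eq_mul, smul_eq_mul]
    field_simp

end Retract

variable {L : Type*} [LieRing L] [LieAlgebra ℂ L] [FiniteDimensional ℂ L]

/-- Both elements lie in `S`, where the form on the Cartan subalgebra is nondegenerate, so they are
proportional with factor `c' / c`. As `K(h, h)` scales by the square of the factor, the factor is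
`1`. -/
lemma IsReductive.isCorootOf_unique (hL : IsReductive L) (H : LieSubalgebra ℂ L)
    [H.IsCartanSubalgebra] {α : Dual ℂ H} (hα : α ≠ 0) {h h' : H} (hh : IsCorootOf H α h)
    (hh' : IsCorootOf H α h') : h = h' := by
  obtain ⟨Z, S, hS, hZ, _⟩ := hL.exists_isCompl
  have hπ := LieIdeal.projection_apply_of_mem_left hS
  have := LieIdeal.isCartanSubalgebra_comap_incl hπ H
  have hle : ⁅(⊤ : LieIdeal ℂ L), (⊤ : LieIdeal ℂ L)⁆ ≤ S := by
    rw [LieSubmodule.lie_le_iff]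
    rintro x - y -
    obtain ⟨a, ha, z, hz, rfl⟩ := (LieSubmodule.mem_sup _ _ y).mp
      (hS.sup_eq_top ▸ LieSubmodule.mem_top y)
    rw [lie_add, hZ z hz, add_zero]
    exact lie_mem_right ℂ L S x a ha
  have key (h : H) (hh : IsCorootOf H α h) : ∃ s : H.comap S.incl, h = cartanIncl S H s ∧
      ∀ x : H.comap S.incl, α (cartanIncl S H x) =
        2 * (traceForm ℂ (H.comap S.incl) S x s / killingForm ℂ L h h) := by
    refine ⟨⟨⟨h, hle hh.1⟩, h.2⟩, rfl, fun x ↦ ?_⟩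
    have h₁ : LieIdeal.projection hS h = ⟨h, hle hh.1⟩ := hπ ⟨h, hle hh.1⟩
    rw [hh.2, coe_cartanIncl_apply, LieIdeal.killingForm_coe_apply hπ, h₁]
    rfl
  obtain ⟨s, hs, h₁⟩ := key h hh
  obtain ⟨s', hs', h₂⟩ := key h' hh'
  set c := killingForm ℂ L h h with hc
  set c' := killingForm ℂ L h' h' with hc'
  have hc₀ : c ≠ 0 := fun h₀ ↦ hα <| by
    ext x
    simp [hh.2, ← hc, h₀]
  have hc₀' : c' ≠ 0 := fun h₀ ↦ hα <| by
    ext x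
    simp [hh'.2, ← hc', h₀]
  have h₃ : c' • s = c • s' := by
    rw [← sub_eq_zero]
    apply (IsKilling.traceForm_cartan_nondegenerate ℂ S (H.comap S.incl)).1
    intro x
    rw [traceForm_comm, map_sub, map_smul, map_smul]
    have := (h₁ x).symm.trans (h₂ x)
    field_simp at this
    simp only [smul_eq_mul]
    linear_combination this
  have h₄ : h' = (c' / c) • h := by
    rw [hs, hs', ← map_smul, div_eq_inv_mul, mul_smul, h₃, smul_smul, inv_mul_cancel₀ hc₀, one_smul]
  have h₅ : c' / c = 1 := by
    have : c' = (c' / c) * ((c' / c) * c) := by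
      conv_lhs => rw [hc', h₄]
      simp [← hc]
    field_simp at this ⊢
    exact this.symm
  rw [h₄, h₅, one_smul]

lemma IsReductive.coroot_eq (hL : IsReductive L) (H : LieSubalgebra ℂ L)
    [H.IsCartanSubalgebra] {α : Dual ℂ H} (hα : α ≠ 0) {h : H} (hh : IsCorootOf H α h) :
    coroot H α = h := by
  have : ∃ h, IsCorootOf H α h := ⟨h, hh⟩
  rw [coroot, dif_pos this]
  exact hL.isCorootOf_unique H hα this.choose_spec hh

lemma IsReductive.coroot_comp_cartanRetract (hL : IsReductive L) {I : LieIdeal ℂ L}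
    {π : L →ₗ⁅ℂ⁆ I} (hπ : ∀ x : I, π x = x) (H : LieSubalgebra ℂ L) [H.IsCartanSubalgebra]
    [IsKilling ℂ I] [(H.comap I.incl).IsCartanSubalgebra] (β : (H.comap I.incl).root) :
    coroot H (β.1.toLinear ∘ₗ cartanRetract hπ H) = cartanIncl I H (IsKilling.coroot β.1) :=
  hL.coroot_eq H (comp_cartanRetract_mem_roots hπ H β).1 (isCorootOf_comp_cartanRetract hπ H β)

end ReductiveLie

/-! ### Symmetry of the pairing for reductive algebras of ADE type. -/

namespace LieIdeal

variable {K L ι : Type*} [Field K] [LieRing L] [LieAlgebra K L] {I : ι → LieIdeal K L}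

lemma isCompl_iSup_ne (h : iSupIndep I) (h' : ⨆ i, I i = ⊤) (i : ι) :
    IsCompl (I i) (⨆ j, ⨆ (_ : j ≠ i), I j) := by
  refine ⟨h i, codisjoint_iff.mpr <| top_unique <| h' ▸ iSup_le fun j ↦ ?_⟩
  rcases eq_or_ne j i with rfl | hj
  · exact le_sup_left
  · exact le_sup_of_le_right (le_iSup₂_of_le j hj le_rfl)

lemma sum_projection_apply [Fintype ι] (h : iSupIndep I) (h' : ⨆ i, I i = ⊤) (x : L) :
    ∑ i, (projection (isCompl_iSup_ne h h' i) x : L) = x := by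
  classical
  have hx : x ∈ ⨆ i, I i := h' ▸ LieSubmodule.mem_top x
  induction hx using LieSubmodule.iSup_induction' with
  | mem i x hx =>
    rw [Finset.sum_eq_single i]
    · exact congrArg Subtype.val (projection_apply_of_mem_left (isCompl_iSup_ne h h' i) ⟨x, hx⟩)
    · intro j _ hj
      have : x ∈ ⨆ k, ⨆ (_ : k ≠ j), I k := le_iSup₂_of_le (f := fun k (_ : k ≠ j) ↦ I k) i hj.symm le_rfl hx
      rw [(projection_apply_eq_zero_iff (isCompl_iSup_ne h h' j)).mpr this, LieSubmodule.coe_zero]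
    · simp
  | zero => simp
  | add x y _ _ hx hy => simp only [map_add, LieSubmodule.coe_add, Finset.sum_add_distrib, hx, hy]

end LieIdeal

namespace ReductiveLie

open LieAlgebra LieModule

lemma IsSimpleOfTypeADE.isKilling {L : Type*} [LieRing L] [LieAlgebra ℂ L]
    [FiniteDimensional ℂ L] (hL : IsSimpleOfTypeADE L) : IsKilling ℂ L := by
  obtain ⟨_, -⟩ := hL
  infer_instance

variable {L : Type*} [LieRing L] [LieAlgebra ℂ L] [FiniteDimensional ℂ L]

/-- The roots of a reductive Lie algebra of type ADE are simply laced. -/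
lemma IsADEType.apply_coroot_comm (hL : IsReductive L) (h : IsADEType L) (H : LieSubalgebra ℂ L)
    [H.IsCartanSubalgebra] {α β : Dual ℂ H} (hα : α ∈ roots H) (hβ : β ∈ roots H) :
    α (coroot H β) = β (coroot H α) := by
  obtain ⟨n, 𝔞, 𝔰, _, h𝔰, hind, hsup⟩ := h
  have hc (i : Fin n) := LieIdeal.isCompl_iSup_ne hind hsup (some i)
  let π (i : Fin n) : L →ₗ⁅ℂ⁆ 𝔰 i := LieIdeal.projection (hc i)
  have hπ (i : Fin n) (x : 𝔰 i) : π i x = x := LieIdeal.projection_apply_of_mem_left (hc i) x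
  have hπ₀ {i j : Fin n} (hij : i ≠ j) (x : 𝔰 i) : π j x = 0 := by
    refine (LieIdeal.projection_apply_eq_zero_iff (hc j)).mpr ?_
    have : some i ≠ some j := by simpa using hij
    exact le_iSup₂_of_le (f := fun k (_ : k ≠ some j) ↦ k.elim 𝔞 𝔰) (some i) this le_rfl x.2
  have (i : Fin n) := (h𝔰 i).isKilling
  have (i : Fin n) := LieIdeal.isCartanSubalgebra_comap_incl (hπ i) H
  have key {α : Dual ℂ H} (hα : α ∈ roots H) : ∃ (i : Fin n) (γ : (H.comap (𝔰 i).incl).root),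
      α = γ.1.toLinear ∘ₗ cartanRetract (hπ i) H := by
    obtain ⟨hα, x, hx, hαx⟩ := hα
    rw [← LieIdeal.sum_projection_apply hind hsup x] at hx
    obtain ⟨o, -, ho⟩ := Finset.exists_ne_zero_of_sum_ne_zero hx
    have hp := LieIdeal.projection_apply_of_mem_left (LieIdeal.isCompl_iSup_ne hind hsup o)
    have h₁ (t : H) := LieIdeal.retract_lie_eq hp t x
    simp only [hαx, map_smul, LieSubmodule.coe_smul] at h₁
    cases o with
    | some i => exact ⟨i, exists_root_of_mem (hπ i) H hα (fun h₀ ↦ ho (congrArg Subtype.val h₀)) fun t ↦ (h₁ t).symm⟩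
    -- `H` acts on the abelian ideal through its projection to it, hence by zero, so no root vector
    -- has a component there.
    | none =>
      refine (hα ?_).elim
      ext t
      have h₂ := h₁ t
      rw [LieIdeal.lie_coe_eq_of_retract hp] at h₂
      have h₃ : ∀ a b : 𝔞, ⁅a, b⁆ = 0 := trivial_lie_zero 𝔞 𝔞
      erw [h₃] at h₂
      simpa using (smul_eq_zero.mp h₂).resolve_right ho
  obtain ⟨i, γ, rfl⟩ := key hα
  obtain ⟨j, δ, rfl⟩ := key hβ
  rw [hL.coroot_comp_cartanRetract, hL.coroot_comp_cartanRetract]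
  rcases eq_or_ne i j with rfl | hij
  · simpa using (h𝔰 i).pairing_comm _ γ δ
  · have h₁ {i j : Fin n} (hij : i ≠ j) (x : H.comap (𝔰 i).incl) :
        cartanRetract (hπ j) H (cartanIncl (𝔰 i) H x) = 0 := by
      ext
      simp [hπ₀ hij]
    simp [h₁ hij, h₁ hij.symm]

end ReductiveLie

/-! ### Gluing along the centre, and the Langlands dual. -/

namespace LieIdeal

variable {K L L' : Type*} [Field K] [LieRing L] [LieAlgebra K L] [LieRing L'] [LieAlgebra K L']

lemma projection_add_projection {I J : LieIdeal K L} (h : IsCompl I J) (x : L) :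
    (projection h x : L) + projection h.symm x = x :=
  Submodule.projection_add_projection_eq_self (LieSubmodule.isCompl_toSubmodule.mpr h) x

lemma projection_apply_of_mem_right {I J : LieIdeal K L} (h : IsCompl I J) (x : J) :
    projection h x = 0 :=
  (projection_apply_eq_zero_iff h).mpr x.2

lemma projection_lie_of_central {S Z : LieIdeal K L} (h : IsCompl S Z)
    (hZ : ∀ z ∈ Z, ∀ x : L, ⁅x, z⁆ = 0) (x y : L) :
    projection h.symm ⁅x, y⁆ = 0 := by
  rw [projection_apply_eq_zero_iff, ← projection_add_projection h y, lie_add,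
    hZ _ (SetLike.coe_mem _), add_zero]
  exact lie_mem_right K L S x _ (SetLike.coe_mem _)

/-- A Lie algebra which is the direct sum of an ideal and a central ideal is determined by these. -/
lemma exists_equiv_of_isCompl_central {S Z : LieIdeal K L} (h : IsCompl S Z)
    (hZ : ∀ z ∈ Z, ∀ x : L, ⁅x, z⁆ = 0) {S' Z' : LieIdeal K L'} (h' : IsCompl S' Z')
    (hZ' : ∀ z ∈ Z', ∀ x : L', ⁅x, z⁆ = 0) (ψ : S ≃ₗ⁅K⁆ S') (ζ : Z ≃ₗ[K] Z') :
    ∃ φ : L ≃ₗ⁅K⁆ L', ∀ s : S, φ s = ψ s := by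
  refine ⟨
    { toFun := fun x ↦ (ψ (projection h x) : L') + ζ (projection h.symm x)
      invFun := fun x ↦ (ψ.symm (projection h' x) : L) + ζ.symm (projection h'.symm x)
      map_add' := fun x y ↦ by simp only [map_add, LieSubmodule.coe_add]; abel
      map_smul' := fun c x ↦ by simp
      map_lie' := fun {x y} ↦ by
        simp only [projection_lie_of_central h hZ, map_zero, LieSubmodule.coe_zero, add_zero,
          LieHom.map_lie, LieEquiv.map_lie, lie_add, hZ' _ (SetLike.coe_mem _)]
        rw [add_lie, ← lie_skew (ζ _ : L'), hZ' _ (SetLike.coe_mem _), neg_zero, add_zero]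
        rfl
      left_inv := fun x ↦ by
        simp [projection_apply_of_mem_left, projection_apply_of_mem_right,
          projection_add_projection]
      right_inv := fun x ↦ by
        simp [projection_apply_of_mem_left, projection_apply_of_mem_right,
          projection_add_projection] }, fun s ↦ ?_⟩
  change (ψ (projection h s) : L') + ζ (projection h.symm s) = ψ s
  simp [projection_apply_of_mem_left, projection_apply_of_mem_right]

end LieIdeal

namespace ReductiveLie

open LieAlgebra LieModule

section

variable {L : Type*} [LieRing L] [LieAlgebra ℂ L] [FiniteDimensional ℂ L] {S Z : LieIdeal ℂ L}
  (h : IsCompl S Z) (hZ : ∀ z ∈ Z, ∀ x : L, ⁅x, z⁆ = 0) (H : LieSubalgebra ℂ L)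
  [H.IsCartanSubalgebra]

include h hZ

/-- Central elements normalize `H`, so `Z ⊆ H`. -/
lemma finrank_cartan_eq : finrank ℂ H = finrank ℂ (H.comap S.incl) + finrank ℂ Z := by
  rw [← finrank_prod]
  have hH (z : L) (hz : z ∈ Z) : z ∈ H := by
    rw [← LieSubalgebra.IsCartanSubalgebra.self_normalizing (H := H),
      LieSubalgebra.mem_normalizer_iff]
    intro y _
    rw [← lie_skew, hZ z hz, neg_zero]
    exact H.zero_mem
  exact LinearEquiv.finrank_eq
    { toFun := fun x ↦ (cartanRetract (LieIdeal.projection_apply_of_mem_left h) H x,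
        LieIdeal.projection h.symm x)
      invFun := fun x ↦ cartanIncl S H x.1 + ⟨x.2, hH x.2 x.2.2⟩
      map_add' := fun x y ↦ by simp
      map_smul' := fun c x ↦ by simp
      left_inv := fun x ↦ by
        ext
        simp [LieIdeal.projection_add_projection]
      right_inv := fun x ↦ by
        ext <;> simp [LieIdeal.projection_apply_of_mem_left, LieIdeal.projection_apply_of_mem_right] }

variable [IsKilling ℂ S] [(H.comap S.incl).IsCartanSubalgebra]

-- The projection of a root vector to `S` is nonzero: otherwise the vector is central and its weight
-- is zero.
omit [IsKilling ℂ S] in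
lemma exists_root_of_mem_roots {α : Dual ℂ H} (hα : α ∈ roots H) :
    ∃ γ : (H.comap S.incl).root,
      γ.1.toLinear ∘ₗ cartanRetract (LieIdeal.projection_apply_of_mem_left h) H = α := by
  have hπ := LieIdeal.projection_apply_of_mem_left h
  obtain ⟨hα, x, hx, hαx⟩ := hα
  have h₁ (t : H) := LieIdeal.retract_lie_eq hπ t x
  simp only [hαx, map_smul, LieSubmodule.coe_smul] at h₁
  have hx₀ : LieIdeal.projection h x ≠ 0 := fun h₀ ↦ hα <| by
    rw [LieIdeal.projection_apply_eq_zero_iff] at h₀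
    ext t
    have := hαx t
    rw [hZ x h₀, eq_comm] at this
    simpa [hx] using this
  obtain ⟨γ, hγ⟩ := exists_root_of_mem hπ H hα hx₀ fun t ↦ (h₁ t).symm
  exact ⟨γ, hγ.symm⟩

end

variable {L L' : Type*} [LieRing L] [LieAlgebra ℂ L] [FiniteDimensional ℂ L]
  [LieRing L'] [LieAlgebra ℂ L'] [FiniteDimensional ℂ L']

/-- A simply laced reductive Lie algebra is isomorphic to every Langlands dual. -/
lemma LanglandsDuality.exists_equiv (hL : IsReductive L) (hL' : IsReductive L')
    {H : LieSubalgebra ℂ L} [H.IsCartanSubalgebra] {H' : LieSubalgebra ℂ L'}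
    [H'.IsCartanSubalgebra] (D : LanglandsDuality H H')
    (hH : ∀ α ∈ roots H, ∀ β ∈ roots H, α (coroot H β) = β (coroot H α)) :
    ∃ φ : L ≃ₗ⁅ℂ⁆ L', ∀ α ∈ roots H, φ (coroot H α : L) = (D.dualCoroot α : L') := by
  obtain ⟨Z, S, hS, hZ, _⟩ := hL.exists_isCompl
  obtain ⟨Z', S', hS', hZ', _⟩ := hL'.exists_isCompl
  have hπ := LieIdeal.projection_apply_of_mem_left hS
  have hπ' := LieIdeal.projection_apply_of_mem_left hS'
  have := LieIdeal.isCartanSubalgebra_comap_incl hπ H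
  have := LieIdeal.isCartanSubalgebra_comap_incl hπ' H'
  have hmem (γ : (H.comap S.incl).root) := comp_cartanRetract_mem_roots hπ H γ
  have hD {α : Dual ℂ H} (hα : α ∈ roots H) : D.dualRoot α ∈ roots H' := by
    rw [D.roots_eq]
    exact ⟨α, hα, rfl⟩
  choose σ hσ using fun γ : (H.comap S.incl).root ↦ exists_root_of_mem_roots hS' hZ' H' (hD (hmem γ))
  have hcoroot (γ : (H.comap S.incl).root) :=
    hL.coroot_comp_cartanRetract hπ H γ
  have hcoroot' (γ : (H.comap S.incl).root) :
      cartanIncl S' H' (IsKilling.coroot (σ γ).1) =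
        D.dualCoroot (γ.1.toLinear ∘ₗ cartanRetract hπ H) := by
    rw [← hL'.coroot_comp_cartanRetract hπ', hσ]
    rfl
  have hσ_bij : Function.Bijective σ := by
    constructor
    · intro γ δ hγδ
      have h₁ : D.dualRoot (γ.1.toLinear ∘ₗ cartanRetract hπ H) =
          D.dualRoot (δ.1.toLinear ∘ₗ cartanRetract hπ H) := by
        rw [← hσ, ← hσ, hγδ]
      -- The dual root determines the root, since its coroot is the root itself.
      have h₂ := (D.coroot_eq _ (hmem γ)).symm.trans
        ((congrArg (coroot H') h₁).trans (D.coroot_eq _ (hmem δ)))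
      have h₃ := D.toEquiv.injective h₂
      ext t
      simpa using LinearMap.congr_fun h₃ (cartanIncl S H t)
    · intro δ
      have h₁ := comp_cartanRetract_mem_roots hπ' H' δ
      rw [D.roots_eq] at h₁
      obtain ⟨α, hα, h₁⟩ := h₁
      obtain ⟨γ, rfl⟩ := exists_root_of_mem_roots hS hZ H hα
      use γ
      have h₂ := (hσ γ).trans h₁
      ext t
      simpa using LinearMap.congr_fun h₂ (cartanIncl S' H' t)
  let σ' := Equiv.ofBijective σ hσ_bij
  -- The only use of symmetry: duality alone gives the transposed pairing.
  have hσ' (i j : (H.comap S.incl).root) :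
      (IsKilling.rootSystem (H'.comap S'.incl)).pairing (σ' i) (σ' j) =
        (IsKilling.rootSystem (H.comap S.incl)).pairing i j := by
    have h₁ : (σ i).1 (IsKilling.coroot (σ j).1) =
        D.dualRoot (i.1.toLinear ∘ₗ cartanRetract hπ H)
          (D.dualCoroot (j.1.toLinear ∘ₗ cartanRetract hπ H)) := by
      rw [← hcoroot', ← hσ]
      simp
    have h₂ : D.dualCoroot (j.1.toLinear ∘ₗ cartanRetract hπ H) = D.toEquiv _ :=
      D.coroot_eq _ (hmem j)
    rw [IsKilling.rootSystem_pairing_apply, IsKilling.rootSystem_pairing_apply]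
    refine h₁.trans ?_
    rw [h₂, LanglandsDuality.dualRoot, asForm, LinearMap.comp_apply, LinearEquiv.coe_coe,
      LinearEquiv.symm_apply_apply, Dual.eval_apply, ← hH _ (hmem i) _ (hmem j), hcoroot]
    simp
  obtain ⟨ψ, hψ⟩ := IsKilling.exists_equiv_of_pairing_eq σ' hσ'
  have hfin : finrank ℂ Z = finrank ℂ Z' := by
    obtain ⟨f, -⟩ := RootPairing.exists_linearEquiv_of_pairing_eq
      (IsKilling.rootSystem (H.comap S.incl)) (IsKilling.rootSystem (H'.comap S'.incl)) σ' hσ'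
    have h₁ := finrank_cartan_eq hS hZ H
    have h₂ := finrank_cartan_eq hS' hZ' H'
    have h₃ := D.toEquiv.finrank_eq
    rw [Subspace.dual_finrank_eq] at h₃
    have h₄ := f.finrank_eq
    rw [Subspace.dual_finrank_eq, Subspace.dual_finrank_eq] at h₄
    omega
  obtain ⟨φ, hφ⟩ := LieIdeal.exists_equiv_of_isCompl_central hS hZ hS' hZ' ψ
    (LinearEquiv.ofFinrankEq _ _ hfin)
  refine ⟨φ, fun α hα ↦ ?_⟩
  obtain ⟨γ, rfl⟩ := exists_root_of_mem_roots hS hZ H hα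
  rw [hcoroot, ← hcoroot', coe_cartanIncl_apply, coe_cartanIncl_apply, hφ, hψ]
  rfl

end ReductiveLie

end

theorem mainTheorem3
    {𝔤 𝔤' : Type*}
    [LieRing 𝔤] [LieAlgebra ℂ 𝔤] [FiniteDimensional ℂ 𝔤]
    [LieRing 𝔤'] [LieAlgebra ℂ 𝔤'] [FiniteDimensional ℂ 𝔤']
    (h_red : ReductiveLie.IsReductive 𝔤) (h_ade : ReductiveLie.IsADEType 𝔤)
    (h_red' : ReductiveLie.IsReductive 𝔤')
    (𝔱 : LieSubalgebra ℂ 𝔤) [𝔱.IsCartanSubalgebra]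
    (𝔱' : LieSubalgebra ℂ 𝔤') [𝔱'.IsCartanSubalgebra]
    (D : ReductiveLie.LanglandsDuality 𝔱 𝔱') :
    (∀ α ∈ ReductiveLie.roots 𝔱, ∀ β ∈ ReductiveLie.roots 𝔱,
      α (ReductiveLie.coroot 𝔱 β) = β (ReductiveLie.coroot 𝔱 α)) ∧
    ∃ φ : 𝔤 ≃ₗ⁅ℂ⁆ 𝔤', ∀ α ∈ ReductiveLie.roots 𝔱,
      φ (ReductiveLie.coroot 𝔱 α : 𝔤) = (D.dualCoroot α : 𝔤') := by
  have h : ∀ α ∈ ReductiveLie.roots 𝔱, ∀ β ∈ ReductiveLie.roots 𝔱,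
      α (ReductiveLie.coroot 𝔱 β) = β (ReductiveLie.coroot 𝔱 α) :=
    fun _ hα _ hβ ↦ h_ade.apply_coroot_comm h_red 𝔱 hα hβ
  exact ⟨h, D.exists_equiv h_red h_red' h⟩
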